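/- **Setting.** $|\cdot|$ is the Euclidean norm of vectors and the induced matrix norm, $|\cdot|_{\mathrm F}$ the Frobenius norm, and $|\xi|_{\mathcal A}=\inf_{y\in\mathcal A}|\xi-y|$. A hybrid time domain is a nonempty set $E\subset\mathbb R_{\ge0}\times\mathbb N$ such that for every $(T,J)\in E$ there are $0=t_0\le t_1\le\dots\le t_{J+1}$ with $E\cap([0,T]\times\{0,\dots,J\})=\bigcup_{j=0}^J[t_j,t_{j+1}]\times\{j\}$; $\Upsilon(E)=\{(t,j)\in E:(t,j+1)\in E\}$. For a signal $f$ on $E$, $\|f\|_{(t,j)}\in[0,\infty]$ is the maximum of $\operatorname{ess\,sup}|f(s,k)|$ over $(s,k)\in E\setminus\Upsilon(E)$ and $\sup|f(s,k)|$ over $(s,k)\in\Upsilon(E)$, both over $s\le t$, $k\le j$. A solution of a hybrid system $\dot\xi=F(\xi)$ ($\xi\in C$), $\xi^+=G(\xi)$ ($\xi\in D$) is a function $\xi$ on a hybrid time domain $\operatorname{dom}\xi$, with values in the state set, that is locally absolutely continuous in $t$ for each $j$, starts in $\overline C\cup D$, lies in $C$ in the interior of each interval of flow and satisfies $\dot\xi=F(\xi)$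 there almost everywhere, and satisfies $\xi(t,j)\in D$, $\xi(t,j+1)=G(\xi(t,j))$ for $(t,j)\in\Upsilon(\operatorname{dom}\xi)$. Solutions need not be maximal. Let $E$ be a hybrid time domain, $\phi_c,\phi_d:E\to\mathbb R^{n\times p}$, $u:E\to\mathbb R^m$, $\nu:E\to\mathbb R^n$, $\theta\in\mathbb R^p$, let $f_c,g_d:\mathbb R^n\times\mathbb R^m\to\mathbb R^n$ be continuous, and let $\gamma_c,\lambda_c,\gamma_d>0$, $\lambda_d\in(0,2)$. The system $\mathcal H_\nu$ has the state $\xi=(x,\hat\theta,\psi,\eta,\tau,k)\in\mathcal X_g=\mathbb R^n\times\mathbb R^p\times\mathbb R^{n\times p}\times\mathbb R^n\times E$, jump set $D=\{\xi\in\mathcal X_g:(\tau,k+1)\in E\}$, flow set $C=\overline{\mathcal X_g\setminus D}$, flows (with $\phi_c,u,\nu$ evaluated at $(\tau,k)$) $$\dot x=f_c(x,u)+\phi_c\theta,\quad \dot{\hat\theta}=\gamma_c\psi^\top(x+\nu+\eta-\psi\hat\theta),\quad \dot\psi=-\lambda_c\psi+\phi_c,\quad \dot\eta=-\lambda_c(x+\nu+\eta)-f_c(x+\nu,u),\quad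 \dot\tau=1,\ \dot k=0,$$ and jumps (with $\phi_d,u,\nu$ evaluated at $(\tau,k)$) $$x^+=g_d(x,u)+\phi_d\theta,\quad \psi^+=(1-\lambda_d)\psi+\phi_d,\quad \eta^+=(1-\lambda_d)(x+\nu+\eta)-g_d(x+\nu,u),$$ $$\hat\theta^+=\hat\theta+\frac{\psi^{+\top}}{\gamma_d+|\psi^+|^2}\big(x^++\nu(\tau,k+1)+\eta^+-\psi^+\hat\theta\big),\quad \tau^+=\tau,\ k^+=k+1.$$ Put $\varepsilon=x+\eta-\psi\theta$ and $\mathcal A_g=\{\xi\in\mathcal X_g:\hat\theta=\theta,\ \varepsilon=0\}$. **Assumptions.** (a) There are $L_c,L_d>0$ with $|f_c(x_1,u)-f_c(x_2,u)|\le L_c|x_1-x_2|$ and $|g_d(x_1,u)-g_d(x_2,u)|\le L_d|x_1-x_2|$ for all $x_1,x_2,u$. (b) There is $\phi_M>0$ with $|\phi_c|_{\mathrm F}\le\phi_M$ on $E$ and $|\phi_d|_{\mathrm F}\le\phi_M$ on $\Upsilon(E)$. Let $\psi_0\ge0$, $\Delta,\mu>0$, $q_M\ge q_m>0$, $\zeta\in(0,1)$,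 and let $\xi$ be a solution of $\mathcal H_\nu$ with $\xi(0,0)\in\mathcal X_g$ and $|\psi(0,0)|_{\mathrm F}\le\psi_0$ such that (c) for all $(t',j'),(t^*,j^*)\in\operatorname{dom}\xi$ with $\Delta\le(t^*-t')+(j^*-j')<\Delta+1$, $$\sum_{j=j'}^{j^*}\int_{\max\{t',t_j\}}^{\min\{t^*,t_{j+1}\}}\psi(s,j)^\top\psi(s,j)\,ds+\sum_{j=j'}^{j^*-1}\psi(t_{j+1},j+1)^\top\psi(t_{j+1},j+1)\ \ge\ \mu I,$$ where $[t_j,t_{j+1}]$ are the intervals of flow of $\operatorname{dom}\xi$. If (c) is void, i.e. $p=0$ or there are no such $(t',j'),(t^*,j^*)$, assume also that $\mu$ is so small that $\sigma<1$ below (otherwise $\sigma<1$ holds automatically). **Constants.** $$\psi_M=\psi_0+\max\Big\{\tfrac1{\lambda_c},\tfrac{\sqrt{2\lambda_d(2-\lambda_d)+16}}{\lambda_d(2-\lambda_d)}\Big\}\phi_M,\quad a_M=\gamma_c\psi_M^2,\quad \mu_0=\min\Big\{\gamma_c,\tfrac1{2(\gamma_d+\psi_M^2)}\Big\}\mu,$$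 $$\sigma=\frac{2\mu_0}{\big(1+\sqrt{(a_M+2)(\Delta+2)^3(a_M(\Delta+2)+1/2)}\big)^2},\quad \kappa_0=\sqrt{\tfrac1{1-\sigma}},\quad \lambda_0=-\frac{\ln(1-\sigma)}{2(\Delta+1)},$$ $$p_m=q_m,\quad p_M=q_m+\frac{q_M\kappa_0^2}{2\lambda_0}+\frac{q_M\kappa_0^2e^{2\lambda_0}}{e^{2\lambda_0}-1},\quad \rho=\sqrt{\frac{2p_M^2}{q_mp_m\zeta}\Big(\frac{2p_M}{q_m}+1\Big)},$$ $$\omega=\tfrac12\min\Big\{\tfrac{q_m}{2p_M}(1-\zeta),-\ln\big(1-\tfrac{q_m}{2p_M}(1-\zeta)\big)\Big\},\quad \lambda_\varepsilon=\tfrac12\min\Big\{\lambda_c(1-\zeta),-\ln\big(1-\tfrac{\lambda_d}2(2-\lambda_d)(1-\zeta)\big)\Big\},$$ $$\rho_\varepsilon=\max\Big\{\tfrac2{\lambda_c\sqrt\zeta},\tfrac{\sqrt{2\lambda_d(2-\lambda_d)+16}}{\lambda_d(2-\lambda_d)\sqrt\zeta}\Big\},\quad \kappa_\nu=\sqrt{\tfrac{2p_M}{p_m}},\quad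 \lambda_\nu=\min\{\omega,\lambda_\varepsilon\},\quad \rho_\nu=\sqrt2\max\{\rho,\rho_\varepsilon\}.$$ **Disturbances.** Along $\xi$ write $\nu(t,j)$, $u(t,j)$ for the values of $\nu,u$ at $(\tau(t,j),k(t,j))$, which is $(t,j)$ if $\tau,k$ start from $0$. For $(t,j)\in\operatorname{dom}\xi$ let $$d_c=-\gamma_c\psi^\top(\varepsilon+\nu),\qquad \alpha_c=-\lambda_c\nu+f_c(x,u)-f_c(x+\nu,u)$$ at $(t,j)$, and for $(t,j)\in\Upsilon(\operatorname{dom}\xi)$ let $$d_d(t,j)=-\frac{\psi(t,j+1)^\top}{\gamma_d+|\psi(t,j+1)|^2}\big(\varepsilon(t,j+1)+\nu(t,j+1)\big),\qquad \alpha_d(t,j)=\big[(1-\lambda_d)\nu+g_d(x,u)-g_d(x+\nu,u)\big](t,j).$$ Let $d=d_d$, $d_\varepsilon=\alpha_d$ on $\Upsilon(\operatorname{dom}\xi)$, $d=d_c$, $d_\varepsilon=\alpha_c$ on the rest of $\operatorname{dom}\xi$, and $d_\nu(t,j)=\sqrt{\|d\|_{(t,j)}^2+\|d_\varepsilon\|_{(t,j)}^2}\in[0,\infty]$.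 **Conclusion.** $\kappa_\nu,\lambda_\nu,\rho_\nu>0$, and for all $(t,j)\in\operatorname{dom}\xi$ $$|\xi(t,j)|_{\mathcal A_g}\le\kappa_\nu e^{-\lambda_\nu(t+j)}|\xi(0,0)|_{\mathcal A_g}+\rho_\nu d_\nu(t,j).$$ Moreover, with $\ell=\max\{\lambda_c+L_c,\ |1-\lambda_d|+L_d\}$, for all $(t,j)\in\operatorname{dom}\xi$ $$|d_c(t,j)|\le\gamma_c\psi_M\big(e^{-\lambda_\varepsilon(t+j)}|\varepsilon(0,0)|+\rho_\varepsilon\,\ell\,\|\nu\|_{(t,j)}+|\nu(t,j)|\big),\qquad |\alpha_c(t,j)|\le(\lambda_c+L_c)|\nu(t,j)|,$$ and for all $(t,j)\in\Upsilon(\operatorname{dom}\xi)$ $$|d_d(t,j)|\le\tfrac1{2\sqrt{\gamma_d}}\big(e^{-\lambda_\varepsilon(t+j+1)}|\varepsilon(0,0)|+\rho_\varepsilon\,\ell\,\|\nu\|_{(t,j+1)}+|\nu(t,j+1)|\big),\qquad |\alpha_d(t,j)|\le(|1-\lambda_d|+L_d)|\nu(t,j)|.$$ -/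

import Mathlib

open MeasureTheory Set
open scoped ENNReal Matrix

noncomputable section

/-! ### Hybrid time domains, hybrid arcs and solutions of hybrid systems -/

/-- `E ⊆ ℝ≥0 × ℕ` is a (nonempty) hybrid time domain: every truncation
`E ∩ ([0,T] × {0,…,J})` with `(T,J) ∈ E` is a finite union `⋃_{j ≤ J} [t_j, t_{j+1}] × {j}` with
`0 = t_0 ≤ t_1 ≤ ⋯ ≤ t_{J+1}`. -/
def IsHybridTimeDomain (E : Set (ℝ × ℕ)) : Prop :=
  E.Nonempty ∧ (∀ q ∈ E, 0 ≤ q.1) ∧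
    ∀ T : ℝ, ∀ J : ℕ, (T, J) ∈ E → ∃ t : ℕ → ℝ, Monotone t ∧ t 0 = 0 ∧
      E ∩ (Icc 0 T ×ˢ Iic J) = {q | q.2 ≤ J ∧ q.1 ∈ Icc (t q.2) (t (q.2 + 1))}

/-- The slice `I^j = {t : (t,j) ∈ E}`. -/
def timeSlice (E : Set (ℝ × ℕ)) (j : ℕ) : Set ℝ := {t | (t, j) ∈ E}

/-- `Υ(E) = {(t,j) ∈ E : (t,j+1) ∈ E}`, the points of `E` from which a jump takes place. -/
def jumpPoints (E : Set (ℝ × ℕ)) : Set (ℝ × ℕ) := {q | q ∈ E ∧ (q.1, q.2 + 1) ∈ E}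

/-- The left end `t_j` of the slice `I^j`; for `j ≥ 1` it is the time of the `j`-th jump. -/
def jumpTime (E : Set (ℝ × ℕ)) (j : ℕ) : ℝ := sInf (timeSlice E j)

/-- The supremum norm `‖f‖_{(t,j)}` of a hybrid signal `f` on `E`: the maximum of the essential
supremum of `|f(s,k)|` over `(s,k) ∈ E ∖ Υ(E)`, `(s,k) ≤ (t,j)`, and of the supremum of `|f(s,k)|`
over `(s,k) ∈ Υ(E)`, `(s,k) ≤ (t,j)`. It is `∞` if the signal is unbounded. -/
def hybridSupNorm {V : Type*} [NormedAddCommGroup V] (E : Set (ℝ × ℕ)) (f : ℝ → ℕ → V)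
    (t : ℝ) (j : ℕ) : ℝ≥0∞ :=
  max
    (⨆ k ∈ Iic j, essSup (fun s => ‖f s k‖ₑ)
      (volume.restrict {s | (s, k) ∈ E \ jumpPoints E ∧ s ≤ t}))
    (⨆ q ∈ {q : ℝ × ℕ | q ∈ jumpPoints E ∧ q.1 ≤ t ∧ q.2 ≤ j}, ‖f q.1 q.2‖ₑ)

/-- A hybrid system with state in `stateSet`: `ξ' = F ξ` on `C`, `ξ⁺ = G ξ` on `D`. -/
structure HybridSystem (X : Type*) where
  stateSet : Set X
  C : Set X
  F : X → X
  D : Set X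
  G : X → X

/-- `ξ` with `dom ξ = S` is a solution of the hybrid system `H`: a hybrid arc (locally absolutely
continuous on every slice of a hybrid time domain) with values in the state set that flows in `C`
according to `F` (almost everywhere) and jumps from `D` according to `G`. The values of `ξ` outside
`S` are irrelevant. Solutions need be neither maximal nor complete. -/
structure HybridSystem.IsSolution {X : Type*} [NormedAddCommGroup X] [NormedSpace ℝ X]
    (H : HybridSystem X) (S : Set (ℝ × ℕ)) (ξ : ℝ → ℕ → X) : Prop where
  dom : IsHybridTimeDomain S
  mem_state : ∀ t j, (t, j) ∈ S → ξ t j ∈ H.stateSet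
  abs_cont : ∀ j a b, a ≤ b → Icc a b ⊆ timeSlice S j →
    AbsolutelyContinuousOnInterval (fun s => ξ s j) a b
  initial : ξ 0 0 ∈ closure H.C ∪ H.D
  flow_mem : ∀ j, ∀ t ∈ interior (timeSlice S j), ξ t j ∈ H.C
  flow : ∀ j, ∀ᵐ t : ℝ, t ∈ interior (timeSlice S j) →
    HasDerivAt (fun s => ξ s j) (H.F (ξ t j)) t
  jump_mem : ∀ t j, (t, j) ∈ jumpPoints S → ξ t j ∈ H.D
  jump : ∀ t j, (t, j) ∈ jumpPoints S → ξ t (j + 1) = H.G (ξ t j)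

/-! ### Matrices -/

open scoped Matrix.Norms.L2Operator in
/-- The matrix norm induced by the Euclidean vector norms. -/
def specNorm {n p : ℕ} (M : Matrix (Fin n) (Fin p) ℝ) : ℝ := ‖M‖

open scoped Matrix.Norms.Frobenius in
/-- The Frobenius norm. -/
def frobNorm {n p : ℕ} (M : Matrix (Fin n) (Fin p) ℝ) : ℝ := ‖M‖

/-- The product of a matrix and a Euclidean vector. -/
def mulE {n p : ℕ} (M : Matrix (Fin n) (Fin p) ℝ) (v : EuclideanSpace ℝ (Fin p)) :
    EuclideanSpace ℝ (Fin n) := WithLp.toLp 2 (M *ᵥ v.ofLp)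

/-! ### The state space `ℝⁿ × ℝᵖ × ℝⁿˣᵖ × ℝⁿ × ℝ × ℝ` with its Euclidean norm -/

/-- The space of the states `ξ = (x, θ̂, ψ, η, τ, k)`. -/
abbrev EstState (n p : ℕ) : Type :=
  EuclideanSpace ℝ (Fin n ⊕ Fin p ⊕ (Fin n × Fin p) ⊕ Fin n ⊕ Unit ⊕ Unit)

namespace EstState

variable {n p : ℕ}

/-- The state with the given components. -/
def mk (x : EuclideanSpace ℝ (Fin n)) (th : EuclideanSpace ℝ (Fin p))
    (psi : Matrix (Fin n) (Fin p) ℝ) (eta : EuclideanSpace ℝ (Fin n)) (tau k : ℝ) :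
    EstState n p :=
  WithLp.toLp 2 (Sum.elim x.ofLp (Sum.elim th.ofLp (Sum.elim (fun q => psi q.1 q.2)
    (Sum.elim eta.ofLp (Sum.elim (fun _ => tau) (fun _ => k))))))

/-- The plant state `x`. -/
def x (ξ : EstState n p) : EuclideanSpace ℝ (Fin n) := WithLp.toLp 2 fun i => ξ (.inl i)

/-- The parameter estimate `θ̂`. -/
def th (ξ : EstState n p) : EuclideanSpace ℝ (Fin p) :=
  WithLp.toLp 2 fun a => ξ (.inr (.inl a))

/-- The auxiliary state `ψ`. -/
def psi (ξ : EstState n p) : Matrix (Fin n) (Fin p) ℝ :=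
  Matrix.of fun i a => ξ (.inr (.inr (.inl (i, a))))

/-- The auxiliary state `η`. -/
def eta (ξ : EstState n p) : EuclideanSpace ℝ (Fin n) :=
  WithLp.toLp 2 fun i => ξ (.inr (.inr (.inr (.inl i))))

/-- The ordinary time `τ`. -/
def tau (ξ : EstState n p) : ℝ := ξ (.inr (.inr (.inr (.inr (.inl ())))))

/-- The jump counter `k` as a real coordinate. -/
def kReal (ξ : EstState n p) : ℝ := ξ (.inr (.inr (.inr (.inr (.inr ())))))

/-- The jump counter `k` as a natural number; on the state set of the estimator the coordinate
`kReal` is a natural number and the floor changes nothing. -/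
def k (ξ : EstState n p) : ℕ := ⌊ξ.kReal⌋₊

end EstState

/-! ### The data, the constants, and the estimator under measurement noise -/

/-- The data of the estimation problem: the hybrid time domain `E`, the regressors, the input and
the measurement noise (signals on `E`; their values outside `E` are irrelevant), the plant maps
`f_c`, `g_d` and the parameter `θ`. -/
structure EstData (n p m : ℕ) where
  E : Set (ℝ × ℕ)
  phic : ℝ → ℕ → Matrix (Fin n) (Fin p) ℝ
  phid : ℝ → ℕ → Matrix (Fin n) (Fin p) ℝ
  u : ℝ → ℕ → EuclideanSpace ℝ (Fin m)
  nu : ℝ → ℕ → EuclideanSpace ℝ (Fin n)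
  fc : EuclideanSpace ℝ (Fin n) → EuclideanSpace ℝ (Fin m) → EuclideanSpace ℝ (Fin n)
  gd : EuclideanSpace ℝ (Fin n) → EuclideanSpace ℝ (Fin m) → EuclideanSpace ℝ (Fin n)
  theta : EuclideanSpace ℝ (Fin p)

/-- The real parameters: the gains `γ_c, λ_c, γ_d, λ_d`, the bounds `φ_M` on the regressors and
`ψ_0` on the initial value of `ψ`, the excitation parameters `Δ, μ`, and the free parameters
`q_m, q_M, ζ`. -/
structure EstParams where
  gamc : ℝ
  lamc : ℝ
  gamd : ℝ
  lamd : ℝ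
  phiM : ℝ
  psi0 : ℝ
  Delta : ℝ
  mu : ℝ
  qm : ℝ
  qM : ℝ
  zeta : ℝ

namespace EstParams

variable (P : EstParams)

/-- The admissible values of the parameters. -/
structure Admissible : Prop where
  gamc_pos : 0 < P.gamc
  lamc_pos : 0 < P.lamc
  gamd_pos : 0 < P.gamd
  lamd_mem : P.lamd ∈ Ioo (0 : ℝ) 2
  phiM_pos : 0 < P.phiM
  psi0_nonneg : 0 ≤ P.psi0
  Delta_pos : 0 < P.Delta
  mu_pos : 0 < P.mu
  qm_pos : 0 < P.qm
  qm_le_qM : P.qm ≤ P.qM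
  zeta_mem : P.zeta ∈ Ioo (0 : ℝ) 1

/-- `ψ_M`. -/
def psiM : ℝ :=
  P.psi0 + max (1 / P.lamc)
    (√(2 * P.lamd * (2 - P.lamd) + 16) / (P.lamd * (2 - P.lamd))) * P.phiM

/-- `a_M`. -/
def aM : ℝ := P.gamc * P.psiM ^ 2

/-- `μ_0`. -/
def mu0 : ℝ := min P.gamc (1 / (2 * (P.gamd + P.psiM ^ 2))) * P.mu

/-- `σ`. -/
def sigma : ℝ :=
  2 * P.mu0 /
    (1 + √((P.aM + 2) * (P.Delta + 2) ^ 3 * (P.aM * (P.Delta + 2) + 1 / 2))) ^ 2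

/-- `κ_0`. -/
def kappa0 : ℝ := √(1 / (1 - P.sigma))

/-- `λ_0`. -/
def lam0 : ℝ := -Real.log (1 - P.sigma) / (2 * (P.Delta + 1))

/-- `p_m`. -/
def pm : ℝ := P.qm

/-- `p_M`. -/
def pM : ℝ :=
  P.qm + P.qM * P.kappa0 ^ 2 / (2 * P.lam0)
    + P.qM * P.kappa0 ^ 2 * Real.exp (2 * P.lam0) / (Real.exp (2 * P.lam0) - 1)

/-- `ω`. -/
def omega : ℝ :=
  1 / 2 * min (P.qm / (2 * P.pM) * (1 - P.zeta))
    (-Real.log (1 - P.qm / (2 * P.pM) * (1 - P.zeta)))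

/-- `ρ`. -/
def rho : ℝ :=
  √(2 * P.pM ^ 2 / (P.qm * P.pm * P.zeta) * (2 * P.pM / P.qm + 1))

/-- `λ_ε`. -/
def lamEps : ℝ :=
  1 / 2 * min (P.lamc * (1 - P.zeta))
    (-Real.log (1 - P.lamd / 2 * (2 - P.lamd) * (1 - P.zeta)))

/-- `ρ_ε`. -/
def rhoEps : ℝ :=
  max (2 / (P.lamc * √P.zeta))
    (√(2 * P.lamd * (2 - P.lamd) + 16) / (P.lamd * (2 - P.lamd) * √P.zeta))

/-- `κ_ν`. -/
def kappaNu : ℝ := √(2 * P.pM / P.pm)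

/-- `λ_ν`. -/
def lamNu : ℝ := min P.omega P.lamEps

/-- `ρ_ν`. -/
def rhoNu : ℝ := √2 * max P.rho P.rhoEps

end EstParams

namespace EstData

variable {n p m : ℕ} (W : EstData n p m) (P : EstParams)

/-- The state set `𝒳_g = ℝⁿ × ℝᵖ × ℝⁿˣᵖ × ℝⁿ × E`. -/
def stateSet : Set (EstState n p) := {ξ | ξ.kReal = ξ.k ∧ (ξ.tau, ξ.k) ∈ W.E}

/-- The jump set `D_g`. -/
def jumpSet : Set (EstState n p) := {ξ | ξ ∈ W.stateSet ∧ (ξ.tau, ξ.k + 1) ∈ W.E}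

/-- The flow set `C_g`. -/
def flowSet : Set (EstState n p) := closure (W.stateSet \ W.jumpSet)

/-- The flow map `F_ν`. -/
def flowMap (ξ : EstState n p) : EstState n p :=
  let u := W.u ξ.tau ξ.k
  let nu := W.nu ξ.tau ξ.k
  let phi := W.phic ξ.tau ξ.k
  let y := ξ.x + nu + ξ.eta
  EstState.mk
    (W.fc ξ.x u + mulE phi W.theta)
    (P.gamc • mulE ξ.psiᵀ (y - mulE ξ.psi ξ.th))
    (-P.lamc • ξ.psi + phi)
    (-P.lamc • (ξ.x + nu + ξ.eta) - W.fc (ξ.x + nu) u)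
    1
    0

/-- The jump map `G_ν`. -/
def jumpMap (ξ : EstState n p) : EstState n p :=
  let u := W.u ξ.tau ξ.k
  let nu := W.nu ξ.tau ξ.k
  let phi := W.phid ξ.tau ξ.k
  let xPlus := W.gd ξ.x u + mulE phi W.theta
  let psiPlus := (1 - P.lamd) • ξ.psi + phi
  let etaPlus := (1 - P.lamd) • (ξ.x + nu + ξ.eta) - W.gd (ξ.x + nu) u
  let yPlus := xPlus + W.nu ξ.tau (ξ.k + 1) + etaPlus
  EstState.mk
    xPlus
    (ξ.th + (1 / (P.gamd + specNorm psiPlus ^ 2)) •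
      mulE psiPlusᵀ (yPlus - mulE psiPlus ξ.th))
    psiPlus
    etaPlus
    ξ.tau
    (ξ.kReal + 1)

/-- The estimator `ℋ_ν` under the measurement noise `ν`. -/
def noisySystem : HybridSystem (EstState n p) where
  stateSet := W.stateSet
  C := W.flowSet
  F := W.flowMap P
  D := W.jumpSet
  G := W.jumpMap P

/-- `ε = x + η - ψ θ`. -/
def eps (ξ : EstState n p) : EuclideanSpace ℝ (Fin n) := ξ.x + ξ.eta - mulE ξ.psi W.theta

/-- The target set `𝒜_g = {ξ ∈ 𝒳_g : θ̂ = θ, ε = 0}`. -/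
def target : Set (EstState n p) := {ξ | ξ ∈ W.stateSet ∧ ξ.th = W.theta ∧ W.eps ξ = 0}

/-- The set of initial states `𝒳_0 = {ξ ∈ 𝒳_g : |ψ|_F ≤ ψ_0}`. -/
def initialSet : Set (EstState n p) := {ξ | ξ ∈ W.stateSet ∧ frobNorm ξ.psi ≤ P.psi0}

/-! The signals below are taken along a solution `ξ` with domain `S`. A signal on `E` is read at
`(τ(t,j), k(t,j))`, which is `(t,j)` when `(τ,k)` starts from `(0,0)`. -/

variable (S : Set (ℝ × ℕ)) (ξ : ℝ → ℕ → EstState n p)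

/-- The noise along the solution. -/
def nuAt (t : ℝ) (j : ℕ) : EuclideanSpace ℝ (Fin n) := W.nu (ξ t j).tau (ξ t j).k

/-- The input along the solution. -/
def uAt (t : ℝ) (j : ℕ) : EuclideanSpace ℝ (Fin m) := W.u (ξ t j).tau (ξ t j).k

/-- `d_c`. -/
def dc (t : ℝ) (j : ℕ) : EuclideanSpace ℝ (Fin p) :=
  -(P.gamc • mulE (ξ t j).psiᵀ (W.eps (ξ t j) + W.nuAt ξ t j))

/-- `d_d`. -/
def dd (t : ℝ) (j : ℕ) : EuclideanSpace ℝ (Fin p) :=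
  -((1 / (P.gamd + specNorm (ξ t (j + 1)).psi ^ 2)) •
    mulE (ξ t (j + 1)).psiᵀ (W.eps (ξ t (j + 1)) + W.nuAt ξ t (j + 1)))

/-- `α_c`. -/
def alphac (t : ℝ) (j : ℕ) : EuclideanSpace ℝ (Fin n) :=
  -P.lamc • W.nuAt ξ t j + W.fc (ξ t j).x (W.uAt ξ t j)
    - W.fc ((ξ t j).x + W.nuAt ξ t j) (W.uAt ξ t j)

/-- `α_d`. -/
def alphad (t : ℝ) (j : ℕ) : EuclideanSpace ℝ (Fin n) :=
  (1 - P.lamd) • W.nuAt ξ t j + W.gd (ξ t j).x (W.uAt ξ t j)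
    - W.gd ((ξ t j).x + W.nuAt ξ t j) (W.uAt ξ t j)

open scoped Classical in
/-- `d`: equal to `d_d` at the jump points and to `d_c` elsewhere. -/
def dTot (t : ℝ) (j : ℕ) : EuclideanSpace ℝ (Fin p) :=
  if (t, j) ∈ jumpPoints S then W.dd P ξ t j else W.dc P ξ t j

open scoped Classical in
/-- `d_ε`: equal to `α_d` at the jump points and to `α_c` elsewhere. -/
def dEps (t : ℝ) (j : ℕ) : EuclideanSpace ℝ (Fin n) :=
  if (t, j) ∈ jumpPoints S then W.alphad P ξ t j else W.alphac P ξ t j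

/-- `d_ν(t,j) = (‖d‖²_{(t,j)} + ‖d_ε‖²_{(t,j)})^{1/2}`. -/
def dNu (t : ℝ) (j : ℕ) : ℝ≥0∞ :=
  (hybridSupNorm S (W.dTot P S ξ) t j ^ 2 + hybridSupNorm S (W.dEps P S ξ) t j ^ 2) ^ (1 / 2 : ℝ)

end EstData

/-! ### Hybrid persistence of excitation -/

/-- `a = (t',j')` and `b = (t*,j*)` satisfy `Δ ≤ (t* - t') + (j* - j') < Δ + 1`. -/
def IsWindow (Δ : ℝ) (a b : ℝ × ℕ) : Prop :=
  Δ ≤ (b.1 - a.1) + ((b.2 : ℝ) - (a.2 : ℝ)) ∧ (b.1 - a.1) + ((b.2 : ℝ) - (a.2 : ℝ)) < Δ + 1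

/-- The excitation matrix of `ψ` on `S` from `a = (t',j')` to `b = (t*,j*)`: the sum over
`j' ≤ j ≤ j*` of the (entrywise) integrals of `ψᵀψ(·,j)` over `I^j ∩ [t',t*]`, which is
`[max(t',t_j), min(t*,t_{j+1})]`, plus the sum over `j' ≤ j < j*` of `ψᵀψ(t_{j+1},j+1)`. -/
def excitation {n p : ℕ} (S : Set (ℝ × ℕ)) (ψ : ℝ → ℕ → Matrix (Fin n) (Fin p) ℝ)
    (a b : ℝ × ℕ) : Matrix (Fin p) (Fin p) ℝ :=
  (∑ j ∈ Finset.Icc a.2 b.2,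
      Matrix.of fun r c => ∫ s in timeSlice S j ∩ Icc a.1 b.1, ((ψ s j)ᵀ * ψ s j) r c)
    + ∑ j ∈ Finset.Ico a.2 b.2,
      (ψ (jumpTime S (j + 1)) (j + 1))ᵀ * ψ (jumpTime S (j + 1)) (j + 1)

/-- The hybrid persistence of excitation condition for `ψ` on `S` with parameters `Δ, μ`. -/
def HybridPE {n p : ℕ} (S : Set (ℝ × ℕ)) (ψ : ℝ → ℕ → Matrix (Fin n) (Fin p) ℝ)
    (Δ μ : ℝ) : Prop :=
  ∀ a ∈ S, ∀ b ∈ S, IsWindow Δ a b →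
    (excitation S ψ a b - μ • (1 : Matrix (Fin p) (Fin p) ℝ)).PosSemidef

end

/-! The parameter error `z = θ - θ̂` follows a gradient flow with jumps, driven by the regressor `ψ`
and perturbed by `d`: the loss of `‖z‖²` dominates the excitation `∑ ‖ψ z‖²` along the solution, and
also, by an optimally weighted Young inequality, the squared deviation of `z` over a window from its
value at the start. Excitation at the frozen initial value thus costs a fixed fraction of `‖z‖²`, so
each window contracts `‖z‖` by `√(1 - σ)` up to the perturbation, and iterating backwards over
windows gives exponential decay. The residual `ε` and the regressor `ψ` both solve a stable linear
hybrid equation with a bounded input. Finally the distance to the target set is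
`√(‖z‖² + ‖ε‖² / (2 + ‖θ‖²))`, which the two bounds combine to estimate. -/

/-! ### Hybrid time domains -/

namespace IsHybridTimeDomain

variable {S : Set (ℝ × ℕ)}

theorem exists_monotone_jumpTimes (hS : IsHybridTimeDomain S) {b : ℝ × ℕ} (hb : b ∈ S) :
    ∃ t : ℕ → ℝ, Monotone t ∧ t 0 = 0 ∧
      ∀ s k, k ≤ b.2 → ((s, k) ∈ S ∧ s ≤ b.1 ↔ s ∈ Icc (t k) (t (k + 1))) := by
  obtain ⟨-, hpos, hS⟩ := hS
  obtain ⟨t, ht_mono, ht_zero, ht⟩ := hS b.1 b.2 hb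
  refine ⟨t, ht_mono, ht_zero, fun s k hk => ?_⟩
  have h := Set.ext_iff.1 ht (s, k)
  simp only [mem_inter_iff, mem_prod, mem_Icc, mem_Iic, mem_ofPred_eq] at h
  exact ⟨fun hs => (h.1 ⟨hs.1, ⟨hpos _ hs.1, hs.2⟩, hk⟩).2,
    fun hs => ⟨(h.2 ⟨hk, hs⟩).1, (h.2 ⟨hk, hs⟩).2.1.2⟩⟩

theorem fst_nonneg (hS : IsHybridTimeDomain S) {b : ℝ × ℕ} (hb : b ∈ S) : 0 ≤ b.1 :=
  hS.2.1 b hb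

theorem zero_mem (hS : IsHybridTimeDomain S) : ((0 : ℝ), 0) ∈ S := by
  obtain ⟨b, hb⟩ := hS.1
  obtain ⟨t, ht_mono, ht_zero, ht⟩ := hS.exists_monotone_jumpTimes hb
  exact ((ht 0 0 (Nat.zero_le _)).2 ⟨ht_zero.le, ht_zero ▸ ht_mono (Nat.zero_le _)⟩).1

theorem zero_le_of_mem (hS : IsHybridTimeDomain S) {b : ℝ × ℕ} (hb : b ∈ S) : ((0 : ℝ), 0) ≤ b :=
  ⟨hS.fst_nonneg hb, Nat.zero_le _⟩

theorem fst_le_of_snd_lt (hS : IsHybridTimeDomain S) {b : ℝ × ℕ} (hb : b ∈ S) {s s' : ℝ}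
    {k k' : ℕ} (h : (s, k) ∈ S) (h' : (s', k') ∈ S) (hs : s ≤ b.1) (hsb : (s', k') ≤ b)
    (hk : k < k') : s ≤ s' := by
  obtain ⟨t, ht_mono, -, ht⟩ := hS.exists_monotone_jumpTimes hb
  have hs_le := ((ht s k (hk.le.trans hsb.2)).1 ⟨h, hs⟩).2
  have hs'_ge := ((ht s' k' hsb.2).1 ⟨h', hsb.1⟩).1
  exact hs_le.trans ((ht_mono hk).trans hs'_ge)

theorem Icc_subset_timeSlice (hS : IsHybridTimeDomain S) {s s' : ℝ} {k : ℕ} (h : (s, k) ∈ S)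
    (h' : (s', k) ∈ S) : Icc s s' ⊆ timeSlice S k := by
  intro r hr
  obtain ⟨t, -, -, ht⟩ := hS.exists_monotone_jumpTimes h'
  have hs := (ht s k le_rfl).1 ⟨h, hr.1.trans hr.2⟩
  have hs' := (ht s' k le_rfl).1 ⟨h', le_rfl⟩
  exact ((ht r k le_rfl).2 ⟨hs.1.trans hr.1, hr.2.trans hs'.2⟩).1

theorem eq_of_mem_jumpPoints (hS : IsHybridTimeDomain S) {s s' : ℝ} {k : ℕ}
    (h : (s, k) ∈ jumpPoints S) (h' : (s', k) ∈ jumpPoints S) : s = s' := by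
  wlog hle : s ≤ s' generalizing s s'
  · exact (this h' h (le_of_not_ge hle)).symm
  exact hle.antisymm (hS.fst_le_of_snd_lt h'.2 h'.1 h.2 le_rfl ⟨hle, le_rfl⟩ k.lt_succ_self)

theorem ae_notMem_jumpPoints (hS : IsHybridTimeDomain S) (k : ℕ) :
    ∀ᵐ s : ℝ, (s, k) ∉ jumpPoints S := by
  have hsub : {s : ℝ | (s, k) ∈ jumpPoints S}.Subsingleton :=
    fun _ h _ h' => hS.eq_of_mem_jumpPoints h h'
  simpa [ae_iff] using hsub.measure_zero volume

theorem jumpTime_eq (hS : IsHybridTimeDomain S) {s : ℝ} {k : ℕ} (h : (s, k) ∈ jumpPoints S) :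
    jumpTime S (k + 1) = s := by
  refine IsLeast.csInf_eq ⟨h.2, fun r hr => ?_⟩
  by_contra! hlt
  exact hlt.not_ge
    (hS.fst_le_of_snd_lt h.2 h.1 hr le_rfl ⟨hlt.le, le_rfl⟩ k.lt_succ_self)

theorem exists_timeSlice_inter_Icc_eq (hS : IsHybridTimeDomain S) {b : ℝ × ℕ} (hb : b ∈ S)
    (r : ℝ) {k : ℕ} (hk : k ≤ b.2) : ∃ c d, timeSlice S k ∩ Icc r b.1 = Icc c d := by
  obtain ⟨t, -, -, ht⟩ := hS.exists_monotone_jumpTimes hb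
  refine ⟨max r (t k), t (k + 1), ?_⟩
  ext s
  have hs := ht s k hk
  simp only [timeSlice, mem_inter_iff, mem_ofPred_eq, mem_Icc, max_le_iff] at *
  tauto

theorem induction_on (hS : IsHybridTimeDomain S) {a b : ℝ × ℕ} (ha : a ∈ S) (hb : b ∈ S)
    (hab : a ≤ b) {Q : ℝ → ℕ → Prop} (base : Q a.1 a.2)
    (flow : ∀ k s s', s ≤ s' → Icc s s' ⊆ timeSlice S k → a ≤ (s, k) → (s', k) ≤ b →
      Q s k → Q s' k)
    (jump : ∀ k s, (s, k) ∈ jumpPoints S → a ≤ (s, k) → (s, k + 1) ≤ b → Q s k → Q s (k + 1)) :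
    Q b.1 b.2 := by
  obtain ⟨t, ht_mono, -, ht⟩ := hS.exists_monotone_jumpTimes hb
  have ha_mem := (ht a.1 a.2 hab.2).1 ⟨ha, hab.1⟩
  suffices key : ∀ k, a.2 ≤ k → k ≤ b.2 → ∀ s, a.1 ≤ s → s ∈ Icc (t k) (t (k + 1)) → Q s k from
    key b.2 hab.2 le_rfl b.1 hab.1 ((ht b.1 b.2 le_rfl).1 ⟨hb, le_rfl⟩)
  intro k hk
  induction k, hk using Nat.le_induction with
  | base =>
    intro hk s has hs
    have hs_mem := (ht s _ hk).2 hs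
    exact flow _ _ _ has (hS.Icc_subset_timeSlice ha hs_mem.1) le_rfl ⟨hs_mem.2, hk⟩ base
  | succ k hk ih =>
    intro hkb s _ hs
    have hpre : t (k + 1) ∈ Icc (t k) (t (k + 1)) := ⟨ht_mono k.le_succ, le_rfl⟩
    have hpost : t (k + 1) ∈ Icc (t (k + 1)) (t (k + 1 + 1)) := ⟨le_rfl, ht_mono (k + 1).le_succ⟩
    have hat : a.1 ≤ t (k + 1) := ha_mem.2.trans (ht_mono (by omega))
    have hpre_mem := (ht _ k (by omega)).2 hpre
    have hpost_mem := (ht _ (k + 1) hkb).2 hpost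
    have hs_mem := (ht _ (k + 1) hkb).2 hs
    exact flow _ _ _ hs.1 (hS.Icc_subset_timeSlice hpost_mem.1 hs_mem.1)
      ⟨hat, hk.trans k.le_succ⟩ ⟨hs_mem.2, hkb⟩
      (jump k _ ⟨hpre_mem.1, hpost_mem.1⟩ ⟨hat, hk⟩ ⟨hpre_mem.2, hkb⟩ (ih (by omega) _ hat hpre))

theorem exists_le_sum_lt_add_one (hS : IsHybridTimeDomain S) {b : ℝ × ℕ} (hb : b ∈ S) {c : ℝ}
    (hc : 0 ≤ c) (hcb : c ≤ b.1 + b.2) :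
    ∃ a ∈ S, a ≤ b ∧ a.1 + a.2 ≤ c ∧ c < a.1 + a.2 + 1 := by
  refine hS.induction_on hS.zero_mem hb (hS.zero_le_of_mem hb)
    (Q := fun s k => c ≤ s + k → ∃ a ∈ S, a ≤ (s, k) ∧ a.1 + a.2 ≤ c ∧ c < a.1 + a.2 + 1)
    (fun hc0 => ⟨(0, 0), hS.zero_mem, le_rfl, by simpa using hc, by simp at hc0 ⊢; linarith⟩)
    (fun k s s' hss hsub _ _ ih hle => ?_) (fun k s hs _ _ ih hle => ?_) hcb
  · rcases le_total c (s + k) with hcs | hcs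
    · obtain ⟨a, ha, has, hac⟩ := ih hcs
      exact ⟨a, ha, has.trans ⟨hss, le_rfl⟩, hac⟩
    · exact ⟨(c - k, k), hsub ⟨by linarith, by linarith⟩, ⟨by simp; linarith, le_rfl⟩, by simp,
        by simp⟩
  · rcases le_total c (s + k) with hcs | hcs
    · obtain ⟨a, ha, has, hac⟩ := ih hcs
      exact ⟨a, ha, has.trans ⟨le_rfl, k.le_succ⟩, hac⟩
    · push_cast at hle
      rcases lt_or_ge c (s + k + 1) with hlt | hge
      · exact ⟨(s, k), hs.1, ⟨le_rfl, k.le_succ⟩, hcs, hlt⟩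
      · exact ⟨(s, k + 1), hs.2, le_rfl, by push_cast; linarith, by push_cast; linarith⟩

end IsHybridTimeDomain

theorem mem_of_mem_interior_timeSlice {S : Set (ℝ × ℕ)} {s : ℝ} {k : ℕ}
    (h : s ∈ interior (timeSlice S k)) : (s, k) ∈ S :=
  interior_subset (s := timeSlice S k) h

theorem Ioo_subset_interior_timeSlice {S : Set (ℝ × ℕ)} {k : ℕ} {s s' : ℝ}
    (h : Icc s s' ⊆ timeSlice S k) : Ioo s s' ⊆ interior (timeSlice S k) :=
  interior_maximal (Ioo_subset_Icc_self.trans h) isOpen_Ioo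

/-! ### Differential inequalities for absolutely continuous functions -/

section DifferentialInequalities

variable {a b : ℝ}

theorem le_add_integral_of_deriv_le {v f : ℝ → ℝ} (hv : AbsolutelyContinuousOnInterval v a b)
    (hab : a ≤ b) (hf : IntegrableOn f (Icc a b)) (h : ∀ᵐ s, s ∈ Ioo a b → deriv v s ≤ f s) :
    v b ≤ v a + ∫ s in Icc a b, f s := by
  have hv_int := hv.integral_deriv_eq_sub
  have hf' : IntervalIntegrable f volume a b :=
    (intervalIntegrable_iff_integrableOn_Icc_of_le hab).2 hf
  have hmono : ∫ s in a..b, deriv v s ≤ ∫ s in a..b, f s := by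
    refine intervalIntegral.integral_mono_ae_restrict hab hv.intervalIntegrable_deriv hf' ?_
    rw [Filter.EventuallyLE, ← restrict_Ioo_eq_restrict_Icc]
    exact (ae_restrict_iff' measurableSet_Ioo).2 h
  simp only [intervalIntegral.integral_of_le hab, ← integral_Icc_eq_integral_Ioc] at hv_int hmono
  linarith

/-- The integrating factor `e^{lt}` makes `w` nonincreasing. -/
theorem le_exp_mul_of_deriv_le_neg_mul {w : ℝ → ℝ} {l : ℝ}
    (hw : AbsolutelyContinuousOnInterval w a b) (hab : a ≤ b)
    (h : ∀ᵐ s, s ∈ Ioo a b → deriv w s ≤ -l * w s) : w b ≤ Real.exp (-l * (b - a)) * w a := by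
  have hexp : AbsolutelyContinuousOnInterval (fun r => Real.exp (l * r)) a b :=
    ContDiffOn.absolutelyContinuousOnInterval (by fun_prop)
  have hmono := le_add_integral_of_deriv_le (hw.fun_mul hexp) hab (f := fun _ => 0) (by simp) (by
    filter_upwards [h, hw.ae_differentiableAt] with r hr hdiff hmem
    have hdiff := hdiff (by rw [uIcc_of_le hab]; exact Ioo_subset_Icc_self hmem)
    have hder : HasDerivAt (fun r => Real.exp (l * r)) (Real.exp (l * r) * l) r := by
      simpa using ((hasDerivAt_id r).const_mul l).exp
    rw [(hdiff.hasDerivAt.fun_mul hder).deriv]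
    nlinarith [hr hmem, Real.exp_pos (l * r)])
  have hquot : Real.exp (-l * (b - a)) = Real.exp (l * a) / Real.exp (l * b) := by
    rw [← Real.exp_sub]
    ring_nf
  rw [hquot, div_mul_eq_mul_div, le_div_iff₀ (Real.exp_pos _)]
  simp only [integral_zero, add_zero] at hmono
  linarith

/-- At a zero of `z` the norm has a minimum, so its derivative is `0`, also where it does not
exist. -/
theorem deriv_norm_le_of_inner_le {V : Type*} [NormedAddCommGroup V] [InnerProductSpace ℝ V]
    {z : ℝ → V} {z' : V} {s C : ℝ} (hz : HasDerivAt z z' s)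
    (hC : inner ℝ (z s) z' ≤ C * ‖z s‖) (h0 : z s = 0 → 0 ≤ C) :
    deriv (fun r => ‖z r‖) s ≤ C := by
  by_cases h : z s = 0
  · have hmin : IsLocalMin (fun r => ‖z r‖) s := Filter.Eventually.of_forall fun r => by simp [h]
    exact hmin.deriv_eq_zero ▸ h0 h
  · have hpos : 0 < ‖z s‖ := norm_pos_iff.2 h
    have hdiff : DifferentiableAt ℝ (fun r => ‖z r‖) s := hz.differentiableAt.norm ℝ h
    have hsq := (hdiff.hasDerivAt.pow 2).unique hz.norm_sq
    simp only [Nat.cast_ofNat, Nat.add_one_sub_one, pow_one] at hsq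
    nlinarith

end DifferentialInequalities

/-! ### Hybrid arcs and integration in hybrid time -/

/-- The hybrid time `(b.1 - a.1) + (b.2 - a.2)` elapsed between `a` and `b`, flow time plus number
of jumps; `IsWindow Δ a b` says that it lies in `[Δ, Δ + 1)`. -/
def elapsedTime (a b : ℝ × ℕ) : ℝ := (b.1 - a.1) + ((b.2 : ℝ) - (a.2 : ℝ))

@[simp]
theorem elapsedTime_self (a : ℝ × ℕ) : elapsedTime a a = 0 := by simp [elapsedTime]

theorem elapsedTime_nonneg {a b : ℝ × ℕ} (hab : a ≤ b) : 0 ≤ elapsedTime a b :=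
  add_nonneg (sub_nonneg.2 hab.1) (sub_nonneg.2 (Nat.cast_le.2 hab.2))

theorem elapsedTime_add_elapsedTime (a b c : ℝ × ℕ) :
    elapsedTime a b + elapsedTime b c = elapsedTime a c := by
  simp only [elapsedTime]
  ring

theorem elapsedTime_le_of_le {a b c : ℝ × ℕ} (hbc : b ≤ c) :
    elapsedTime a b ≤ elapsedTime a c := by
  linarith [elapsedTime_add_elapsedTime a b c, elapsedTime_nonneg hbc]

/-- A function that is locally absolutely continuous on every slice of `S`, the regularity of the
state of a hybrid system. -/
def IsHybridArc {X : Type*} [PseudoMetricSpace X] (S : Set (ℝ × ℕ)) (v : ℝ → ℕ → X) : Prop :=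
  ∀ j a b, a ≤ b → Icc a b ⊆ timeSlice S j → AbsolutelyContinuousOnInterval (fun s => v s j) a b

/-- A function that is continuous on every compact interval of every slice of `S`, the regularity
needed to integrate it in hybrid time. -/
def IsSlicewiseContinuous {X : Type*} [TopologicalSpace X] (S : Set (ℝ × ℕ)) (f : ℝ → ℕ → X) :
    Prop :=
  ∀ k c d, Icc c d ⊆ timeSlice S k → ContinuousOn (fun s => f s k) (Icc c d)

/-- The integral of `f` over the part of `S` between `a` and `b`: the integrals over the intervals
of flow plus the values right after the jumps, the sum that `excitation` forms of `ψᵀψ`. -/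
noncomputable def hybridIntegral (S : Set (ℝ × ℕ)) (f : ℝ → ℕ → ℝ) (a b : ℝ × ℕ) : ℝ :=
  (∑ k ∈ Finset.Icc a.2 b.2, ∫ s in timeSlice S k ∩ Icc a.1 b.1, f s k)
    + ∑ k ∈ Finset.Ico a.2 b.2, f (jumpTime S (k + 1)) (k + 1)

section HybridIntegral

variable {S : Set (ℝ × ℕ)} {f : ℝ → ℕ → ℝ}

theorem integral_timeSlice_inter_Icc_eq_zero {a s : ℝ} {k : ℕ}
    (h : ∀ r, (r, k) ∈ S → r ∈ Icc a s → r = s) (φ : ℝ → ℝ) :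
    ∫ r in timeSlice S k ∩ Icc a s, φ r = 0 := by
  have hnull : volume (timeSlice S k ∩ Icc a s) = 0 := Set.Subsingleton.measure_zero
    (fun _ hx _ hy => (h _ hx.1 hx.2).trans (h _ hy.1 hy.2).symm) _
  rw [Measure.restrict_eq_zero.2 hnull, integral_zero_measure]

@[simp]
theorem hybridIntegral_zero (a b : ℝ × ℕ) : hybridIntegral S (fun _ _ => 0) a b = 0 := by
  simp [hybridIntegral]

@[simp]
theorem hybridIntegral_self (a : ℝ × ℕ) : hybridIntegral S f a a = 0 := by
  simp only [hybridIntegral, Finset.Icc_self, Finset.sum_singleton, Finset.Ico_self,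
    Finset.sum_empty, add_zero]
  exact integral_timeSlice_inter_Icc_eq_zero (fun _ _ hr => le_antisymm hr.2 hr.1) _

theorem hybridIntegral_const_mul (c : ℝ) (a b : ℝ × ℕ) :
    hybridIntegral S (fun s k => c * f s k) a b = c * hybridIntegral S f a b := by
  simp only [hybridIntegral, integral_const_mul, ← Finset.mul_sum, mul_add]

theorem IsHybridTimeDomain.integrableOn_timeSlice (hS : IsHybridTimeDomain S)
    (hf : IsSlicewiseContinuous S f) {b : ℝ × ℕ} (hb : b ∈ S) {k : ℕ} (hk : k ≤ b.2) (r : ℝ) :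
    IntegrableOn (fun s => f s k) (timeSlice S k ∩ Icc r b.1) := by
  obtain ⟨c, d, hcd⟩ := hS.exists_timeSlice_inter_Icc_eq hb r hk
  exact hcd ▸ (hf k c d (hcd ▸ inter_subset_left)).integrableOn_Icc

theorem IsHybridTimeDomain.integral_timeSlice_add_integral (hS : IsHybridTimeDomain S)
    (hf : IsSlicewiseContinuous S f) {k : ℕ} {r s s' : ℝ} (hss : s ≤ s')
    (hsub : Icc s s' ⊆ timeSlice S k) (hr : r ≤ s) :
    (∫ x in timeSlice S k ∩ Icc r s, f x k) + ∫ x in Icc s s', f x k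
      = ∫ x in timeSlice S k ∩ Icc r s', f x k := by
  have hunion : timeSlice S k ∩ Icc r s' = (timeSlice S k ∩ Icc r s) ∪ Ioc s s' := by
    ext x
    constructor
    · rintro ⟨hxk, hx⟩
      exact (le_or_gt x s).imp (fun h => ⟨hxk, hx.1, h⟩) (fun h => ⟨h, hx.2⟩)
    · rintro (⟨hxk, hx⟩ | hx)
      · exact ⟨hxk, hx.1, hx.2.trans hss⟩
      · exact ⟨hsub ⟨hx.1.le, hx.2⟩, hr.trans hx.1.le, hx.2⟩
  have hdisj : Disjoint (timeSlice S k ∩ Icc r s) (Ioc s s') :=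
    Set.disjoint_left.2 fun x hx hx' => hx'.1.not_ge hx.2.2
  rw [hunion, integral_Icc_eq_integral_Ioc]
  refine (setIntegral_union hdisj measurableSet_Ioc ?_ ?_).symm
  · exact hS.integrableOn_timeSlice hf (hsub (left_mem_Icc.2 hss)) le_rfl r
  · exact (hf k s s' hsub).integrableOn_Icc.mono_set Ioc_subset_Icc_self

theorem IsHybridTimeDomain.hybridIntegral_add_integral (hS : IsHybridTimeDomain S)
    (hf : IsSlicewiseContinuous S f) {a : ℝ × ℕ} {k : ℕ} {s s' : ℝ} (hss : s ≤ s')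
    (hsub : Icc s s' ⊆ timeSlice S k) (ha : a ≤ (s, k)) :
    hybridIntegral S f a (s, k) + ∫ r in Icc s s', f r k = hybridIntegral S f a (s', k) := by
  have hs : (s, k) ∈ S := hsub (left_mem_Icc.2 hss)
  have hs' : (s', k) ∈ S := hsub (right_mem_Icc.2 hss)
  have hearlier : ∑ j ∈ Finset.Ico a.2 k, ∫ x in timeSlice S j ∩ Icc a.1 s', f x j
      = ∑ j ∈ Finset.Ico a.2 k, ∫ x in timeSlice S j ∩ Icc a.1 s, f x j := by
    refine Finset.sum_congr rfl fun j hj => ?_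
    congr 2
    ext r
    refine and_congr_right fun hr => and_congr_right fun _ => ⟨fun hrs => ?_, (·.trans hss)⟩
    exact hS.fst_le_of_snd_lt hs' hr hs hrs ⟨hss, le_rfl⟩ (Finset.mem_Ico.1 hj).2
  have hlast := hS.integral_timeSlice_add_integral hf hss hsub ha.1
  simp only [hybridIntegral, ← Finset.Ico_insert_right ha.2,
    Finset.sum_insert Finset.right_notMem_Ico, hearlier, ← hlast]
  ring

theorem IsHybridTimeDomain.hybridIntegral_jump (hS : IsHybridTimeDomain S) {a : ℝ × ℕ} {k : ℕ}
    {s : ℝ} (hs : (s, k) ∈ jumpPoints S) (ha : a ≤ (s, k)) :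
    hybridIntegral S f a (s, k + 1) = hybridIntegral S f a (s, k) + f s (k + 1) := by
  have hnew : ∫ r in timeSlice S (k + 1) ∩ Icc a.1 s, f r (k + 1) = 0 :=
    integral_timeSlice_inter_Icc_eq_zero (fun r hr hrs => le_antisymm hrs.2
      (hS.fst_le_of_snd_lt hs.2 hs.1 hr le_rfl ⟨hrs.2, le_rfl⟩ k.lt_succ_self)) _
  have hak : a.2 ≤ k := ha.2
  simp only [hybridIntegral, Finset.sum_Ico_succ_top hak, hS.jumpTime_eq hs,
    ← Finset.insert_Icc_right_eq_Icc_add_one (hak.trans k.le_succ),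
    Finset.sum_insert (show k + 1 ∉ Finset.Icc a.2 k by simp), hnew]
  ring

end HybridIntegral

namespace IsHybridArc

variable {S : Set (ℝ × ℕ)}

theorem comp_lipschitz {X Y : Type*} [PseudoMetricSpace X] [PseudoMetricSpace Y] {v : ℝ → ℕ → X}
    (hv : IsHybridArc S v) {L : X → Y} {K : NNReal} (hL : LipschitzWith K L) :
    IsHybridArc S fun s k => L (v s k) := by
  intro j a b hab hsub
  refine squeeze_zero (fun t => Finset.sum_nonneg fun i _ => dist_nonneg) (fun t => ?_)
    (by simpa using Filter.Tendsto.const_mul (K : ℝ) (hv j a b hab hsub))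
  rw [Finset.mul_sum]
  exact Finset.sum_le_sum fun i _ => hL.dist_le_mul _ _

theorem isSlicewiseContinuous {X : Type*} [SeminormedAddCommGroup X] {v : ℝ → ℕ → X}
    (hv : IsHybridArc S v) : IsSlicewiseContinuous S v := by
  intro k c d hsub
  rcases le_or_gt c d with hcd | hcd
  · simpa [uIcc_of_le hcd] using (hv k c d hcd hsub).continuousOn
  · simp [Icc_eq_empty_of_lt hcd]

theorem ae_differentiableAt {v : ℝ → ℕ → ℝ} (hv : IsHybridArc S v) {k : ℕ} {s s' : ℝ}
    (hss : s ≤ s') (hsub : Icc s s' ⊆ timeSlice S k) :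
    ∀ᵐ r, r ∈ Ioo s s' → DifferentiableAt ℝ (fun r => v r k) r := by
  filter_upwards [(hv k s s' hss hsub).ae_differentiableAt] with r hr hmem
  exact hr (uIcc_of_le hss ▸ Ioo_subset_Icc_self hmem)

theorem le_add_hybridIntegral {v f : ℝ → ℕ → ℝ} {C : ℝ} (hv : IsHybridArc S v)
    (hS : IsHybridTimeDomain S) {a b : ℝ × ℕ} (ha : a ∈ S) (hb : b ∈ S) (hab : a ≤ b)
    (hf : IsSlicewiseContinuous S f)
    (flow : ∀ k, ∀ᵐ s, s ∈ interior (timeSlice S k) → a ≤ (s, k) → (s, k) ≤ b →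
      DifferentiableAt ℝ (fun r => v r k) s → deriv (fun r => v r k) s ≤ f s k + C)
    (jump : ∀ k s, (s, k) ∈ jumpPoints S → a ≤ (s, k) → (s, k + 1) ≤ b →
      v s (k + 1) ≤ v s k + f s (k + 1) + C) :
    v b.1 b.2 ≤ v a.1 a.2 + hybridIntegral S f a b + C * elapsedTime a b := by
  refine hS.induction_on ha hb hab
    (Q := fun s k => v s k ≤ v a.1 a.2 + hybridIntegral S f a (s, k) + C * elapsedTime a (s, k))
    (by simp) ?_ ?_
  · intro k s s' hss hsub has hsb ih
    have hfi : IntegrableOn (fun r => f r k) (Icc s s') := (hf k s s' hsub).integrableOn_Icc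
    have hcompare := le_add_integral_of_deriv_le (hv k s s' hss hsub) hss (f := fun r => f r k + C)
      (hfi.add (by simp)) (by
        filter_upwards [flow k, hv.ae_differentiableAt hss hsub] with r hr hdiff hmem
        exact hr (Ioo_subset_interior_timeSlice hsub hmem) (has.trans ⟨hmem.1.le, le_rfl⟩)
          ⟨hmem.2.le.trans hsb.1, hsb.2⟩ (hdiff hmem))
    rw [integral_add hfi (by simp)] at hcompare
    simp only [integral_const, MeasurableSet.univ, measureReal_restrict_apply, univ_inter,
      Real.volume_real_Icc_of_le hss, smul_eq_mul] at hcompare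
    have hsplit := hS.hybridIntegral_add_integral hf hss hsub has
    simp only [elapsedTime] at ih ⊢
    linarith
  · intro k s hs has hsb ih
    have hstep := jump k s hs has hsb
    rw [hS.hybridIntegral_jump hs has]
    simp only [elapsedTime] at ih ⊢
    push_cast
    linarith

end IsHybridArc

/-! ### Matrices acting on Euclidean vectors -/

section MulE

variable {n p : ℕ}

theorem mulE_sub (M : Matrix (Fin n) (Fin p) ℝ) (v w : EuclideanSpace ℝ (Fin p)) :
    mulE M (v - w) = mulE M v - mulE M w := by
  simp [mulE, Matrix.mulVec_sub]

theorem mulE_add (M : Matrix (Fin n) (Fin p) ℝ) (v w : EuclideanSpace ℝ (Fin p)) :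
    mulE M (v + w) = mulE M v + mulE M w := by
  simp [mulE, Matrix.mulVec_add]

theorem add_mulE (M N : Matrix (Fin n) (Fin p) ℝ) (v : EuclideanSpace ℝ (Fin p)) :
    mulE (M + N) v = mulE M v + mulE N v := by
  simp [mulE, Matrix.add_mulVec]

theorem smul_mulE (c : ℝ) (M : Matrix (Fin n) (Fin p) ℝ) (v : EuclideanSpace ℝ (Fin p)) :
    mulE (c • M) v = c • mulE M v := by
  simp [mulE, Matrix.smul_mulVec]

theorem inner_mulE_transpose (M : Matrix (Fin n) (Fin p) ℝ) (v : EuclideanSpace ℝ (Fin p))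
    (w : EuclideanSpace ℝ (Fin n)) : inner ℝ v (mulE Mᵀ w) = inner ℝ (mulE M v) w := by
  simp only [mulE, EuclideanSpace.inner_eq_star_dotProduct, star_trivial]
  rw [dotProduct_comm, Matrix.dotProduct_mulVec, Matrix.vecMul_transpose, dotProduct_comm]

theorem norm_mulE_sq (M : Matrix (Fin n) (Fin p) ℝ) (v : EuclideanSpace ℝ (Fin p)) :
    ‖mulE M v‖ ^ 2 = v.ofLp ⬝ᵥ (Mᵀ * M) *ᵥ v.ofLp := by
  rw [← real_inner_self_eq_norm_sq, ← inner_mulE_transpose, EuclideanSpace.inner_eq_star_dotProduct,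
    star_trivial, dotProduct_comm]
  simp [mulE, Matrix.mulVec_mulVec]

theorem specNorm_nonneg (M : Matrix (Fin n) (Fin p) ℝ) : 0 ≤ specNorm M := by
  open scoped Matrix.Norms.L2Operator in exact norm_nonneg M

theorem specNorm_transpose (M : Matrix (Fin n) (Fin p) ℝ) : specNorm Mᵀ = specNorm M := by
  have htrans := Matrix.l2_opNorm_conjTranspose M
  rwa [Matrix.conjTranspose_eq_transpose_of_trivial] at htrans

theorem norm_mulE_le (M : Matrix (Fin n) (Fin p) ℝ) (v : EuclideanSpace ℝ (Fin p)) :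
    ‖mulE M v‖ ≤ specNorm M * ‖v‖ :=
  Matrix.l2_opNorm_mulVec M v

theorem norm_mulE_transpose_le (M : Matrix (Fin n) (Fin p) ℝ) (v : EuclideanSpace ℝ (Fin n)) :
    ‖mulE Mᵀ v‖ ≤ specNorm M * ‖v‖ :=
  specNorm_transpose M ▸ norm_mulE_le Mᵀ v

theorem frobNorm_nonneg (M : Matrix (Fin n) (Fin p) ℝ) : 0 ≤ frobNorm M := by
  open scoped Matrix.Norms.Frobenius in exact norm_nonneg M

theorem frobNorm_sq (M : Matrix (Fin n) (Fin p) ℝ) : frobNorm M ^ 2 = ∑ i, ∑ j, M i j ^ 2 := by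
  open scoped Matrix.Norms.Frobenius in
  have hdef : frobNorm M = _ := Matrix.frobenius_norm_def M
  rw [hdef, ← Real.sqrt_eq_rpow, Real.sq_sqrt (by positivity)]
  simp

theorem frobNorm_eq_norm (M : Matrix (Fin n) (Fin p) ℝ) :
    frobNorm M = ‖(WithLp.toLp 2 fun q : Fin n × Fin p => M q.1 q.2 :
      EuclideanSpace ℝ (Fin n × Fin p))‖ := by
  rw [← sq_eq_sq₀ (frobNorm_nonneg M) (norm_nonneg _), frobNorm_sq, EuclideanSpace.norm_sq_eq,
    Fintype.sum_prod_type]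
  simp

theorem norm_mulE_le_frobNorm (M : Matrix (Fin n) (Fin p) ℝ) (v : EuclideanSpace ℝ (Fin p)) :
    ‖mulE M v‖ ≤ frobNorm M * ‖v‖ := by
  rw [← sq_le_sq₀ (norm_nonneg _) (mul_nonneg (frobNorm_nonneg M) (norm_nonneg v)), mul_pow,
    frobNorm_sq, EuclideanSpace.norm_sq_eq, EuclideanSpace.norm_sq_eq, Finset.sum_mul]
  refine Finset.sum_le_sum fun i _ => ?_
  simp only [mulE, Real.norm_eq_abs, sq_abs]
  exact Finset.sum_mul_sq_le_sq_mul_sq Finset.univ (fun j => M i j) fun j => v j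

theorem specNorm_le_frobNorm (M : Matrix (Fin n) (Fin p) ℝ) : specNorm M ≤ frobNorm M :=
  ContinuousLinearMap.opNorm_le_bound _ (frobNorm_nonneg M) fun v => norm_mulE_le_frobNorm M v

end MulE

/-! ### The quadratic form of the excitation matrix -/

section Excitation

variable {n p : ℕ} {S : Set (ℝ × ℕ)} {ψ : ℝ → ℕ → Matrix (Fin n) (Fin p) ℝ} {a b : ℝ × ℕ} {μ : ℝ}

theorem IsSlicewiseContinuous.norm_mulE_sq (hψ : IsSlicewiseContinuous S ψ)
    (v : EuclideanSpace ℝ (Fin p)) : IsSlicewiseContinuous S fun s k => ‖mulE (ψ s k) v‖ ^ 2 := by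
  intro k c d hsub
  have hψk := hψ k c d hsub
  unfold mulE
  fun_prop

theorem dotProduct_excitation_mulVec (hS : IsHybridTimeDomain S) (hψ : IsSlicewiseContinuous S ψ)
    (hb : b ∈ S) (v : EuclideanSpace ℝ (Fin p)) :
    v.ofLp ⬝ᵥ excitation S ψ a b *ᵥ v.ofLp
      = hybridIntegral S (fun s k => ‖mulE (ψ s k) v‖ ^ 2) a b := by
  have hintegrable : ∀ k ∈ Finset.Icc a.2 b.2, ∀ r c,
      IntegrableOn (fun s => ((ψ s k)ᵀ * ψ s k) r c) (timeSlice S k ∩ Icc a.1 b.1) := by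
    intro k hk r c
    refine hS.integrableOn_timeSlice (f := fun s k => ((ψ s k)ᵀ * ψ s k) r c) (fun j t t' ht => ?_)
      hb (Finset.mem_Icc.1 hk).2 a.1
    have hψj := hψ j t t' ht
    have hgram : ContinuousOn (fun s => (ψ s j)ᵀ * ψ s j) (Icc t t') := by fun_prop
    exact continuousOn_pi.1 (continuousOn_pi.1 hgram r) c
  simp only [hybridIntegral, excitation, Matrix.add_mulVec, dotProduct_add, Matrix.sum_mulVec,
    dotProduct_sum, norm_mulE_sq]
  congr 1
  refine Finset.sum_congr rfl fun k hk => ?_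
  simp only [dotProduct, Matrix.mulVec, Matrix.of_apply]
  rw [integral_finsetSum _ fun r _ =>
    (integrable_finsetSum _ fun c _ => (hintegrable k hk r c).mul_const _).const_mul _]
  refine Finset.sum_congr rfl fun r _ => ?_
  rw [integral_const_mul, integral_finsetSum _ fun c _ => (hintegrable k hk r c).mul_const _]
  simp only [integral_mul_const]

theorem mul_norm_sq_le_of_posSemidef {M : Matrix (Fin p) (Fin p) ℝ}
    (h : (M - μ • (1 : Matrix (Fin p) (Fin p) ℝ)).PosSemidef) (v : EuclideanSpace ℝ (Fin p)) :
    μ * ‖v‖ ^ 2 ≤ v.ofLp ⬝ᵥ M *ᵥ v.ofLp := by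
  have hform := h.dotProduct_mulVec_nonneg v.ofLp
  rw [star_trivial, Matrix.sub_mulVec, dotProduct_sub, Matrix.smul_mulVec, Matrix.one_mulVec,
    dotProduct_smul, smul_eq_mul, sub_nonneg] at hform
  rwa [← real_inner_self_eq_norm_sq, EuclideanSpace.inner_eq_star_dotProduct, star_trivial]

theorem mul_norm_sq_le_hybridIntegral (hS : IsHybridTimeDomain S) (hψ : IsSlicewiseContinuous S ψ)
    (hb : b ∈ S) (hμ : (excitation S ψ a b - μ • (1 : Matrix (Fin p) (Fin p) ℝ)).PosSemidef)
    (v : EuclideanSpace ℝ (Fin p)) :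
    μ * ‖v‖ ^ 2 ≤ hybridIntegral S (fun s k => ‖mulE (ψ s k) v‖ ^ 2) a b :=
  (mul_norm_sq_le_of_posSemidef hμ v).trans_eq (dotProduct_excitation_mulVec hS hψ hb v)

theorem le_sq_mul_elapsedTime_of_excitation [NeZero p] (hS : IsHybridTimeDomain S)
    (hψ : IsSlicewiseContinuous S ψ) {ψM : ℝ} (hbound : ∀ s k, (s, k) ∈ S → specNorm (ψ s k) ≤ ψM)
    (ha : a ∈ S) (hb : b ∈ S) (hab : a ≤ b)
    (hμ : (excitation S ψ a b - μ • (1 : Matrix (Fin p) (Fin p) ℝ)).PosSemidef) :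
    μ ≤ ψM ^ 2 * elapsedTime a b := by
  set v : EuclideanSpace ℝ (Fin p) := EuclideanSpace.single 0 1 with hv
  have hv_norm : ‖v‖ = 1 := by simp [hv]
  have hsq : ∀ s k, (s, k) ∈ S → ‖mulE (ψ s k) v‖ ^ 2 ≤ ψM ^ 2 := fun s k hs => by
    gcongr
    exact (norm_mulE_le _ _).trans (by simpa [hv_norm] using hbound s k hs)
  have hquad := mul_norm_sq_le_hybridIntegral hS hψ hb hμ v
  have hzero : IsHybridArc S fun _ _ => (0 : ℝ) := fun _ _ _ _ _ =>
    ContDiffOn.absolutelyContinuousOnInterval (by fun_prop)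
  have hcompare := hzero.le_add_hybridIntegral hS ha hb hab (C := ψM ^ 2)
    (f := fun s k => -1 * ‖mulE (ψ s k) v‖ ^ 2)
    (fun k c d hsub => continuousOn_const.mul (hψ.norm_mulE_sq v k c d hsub))
    (fun k => .of_forall fun s hs _ _ _ => by
      have := hsq s k (mem_of_mem_interior_timeSlice hs)
      simp only [deriv_const]
      linarith)
    (fun k s hs _ _ => by
      have := hsq s (k + 1) hs.2
      linarith)
  rw [hybridIntegral_const_mul] at hcompare
  rw [hv_norm] at hquad
  linarith

end Excitation

section HybridSupNorm

variable {V V' : Type*} [NormedAddCommGroup V] [NormedAddCommGroup V'] {S : Set (ℝ × ℕ)}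
  {f : ℝ → ℕ → V} {t : ℝ} {j : ℕ}

theorem enorm_le_hybridSupNorm_of_mem_jumpPoints {s : ℝ} {k : ℕ} (hs : (s, k) ∈ jumpPoints S)
    (hst : s ≤ t) (hkj : k ≤ j) : ‖f s k‖ₑ ≤ hybridSupNorm S f t j := by
  refine le_trans ?_ (le_max_right _ _)
  exact le_iSup₂_of_le (f := fun (q : ℝ × ℕ) (_ : q ∈ {q : ℝ × ℕ | q ∈ jumpPoints S ∧ q.1 ≤ t ∧
    q.2 ≤ j}) => ‖f q.1 q.2‖ₑ) (s, k) ⟨hs, hst, hkj⟩ le_rfl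

theorem essSup_enorm_le_hybridSupNorm {k : ℕ} (hkj : k ≤ j) :
    essSup (fun s => ‖f s k‖ₑ) (volume.restrict {s | (s, k) ∈ S \ jumpPoints S ∧ s ≤ t})
      ≤ hybridSupNorm S f t j := by
  refine le_trans ?_ (le_max_left _ _)
  exact le_iSup₂_of_le (f := fun (k : ℕ) (_ : k ∈ Iic j) => essSup (fun s => ‖f s k‖ₑ)
    (volume.restrict {s | (s, k) ∈ S \ jumpPoints S ∧ s ≤ t})) k hkj le_rfl

theorem IsHybridTimeDomain.ae_enorm_le_hybridSupNorm (hS : IsHybridTimeDomain S) {k : ℕ}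
    (hkj : k ≤ j) :
    ∀ᵐ s, (s, k) ∈ S → s ≤ t → ‖f s k‖ₑ ≤ hybridSupNorm S f t j := by
  filter_upwards [ae_imp_of_ae_restrict (ae_le_essSup (f := fun s => ‖f s k‖ₑ)
    (μ := volume.restrict {s | (s, k) ∈ S \ jumpPoints S ∧ s ≤ t})),
    hS.ae_notMem_jumpPoints k] with s hs hjump hmem hst
  exact (hs ⟨⟨hmem, hjump⟩, hst⟩).trans (essSup_enorm_le_hybridSupNorm hkj)

theorem hybridSupNorm_le_const_mul {g : ℝ → ℕ → V'} {c : ℝ} (h : ∀ s k, ‖f s k‖ ≤ c * ‖g s k‖) :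
    hybridSupNorm S f t j ≤ ENNReal.ofReal c * hybridSupNorm S g t j := by
  have henorm : ∀ s k, ‖f s k‖ₑ ≤ ENNReal.ofReal c * ‖g s k‖ₑ := fun s k => by
    rw [← ofReal_norm, ← ofReal_norm, ← ENNReal.ofReal_mul' (norm_nonneg _)]
    exact ENNReal.ofReal_le_ofReal (h s k)
  refine max_le (iSup₂_le fun k hk => ?_) (iSup₂_le fun q hq => ?_)
  · refine (essSup_mono_ae (Filter.Eventually.of_forall fun s => henorm s k)).trans ?_
    rw [ENNReal.essSup_const_mul]
    exact mul_le_mul_right (essSup_enorm_le_hybridSupNorm hk) _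
  · exact (henorm _ _).trans
      (mul_le_mul_right (enorm_le_hybridSupNorm_of_mem_jumpPoints hq.1 hq.2.1 hq.2.2) _)

end HybridSupNorm

/-- Up to the horizon `b`, the arc `y` solves the hybrid equation `y' = F y`, `y⁺ = G y` with
additive perturbations bounded by `D`. The maps may depend on the hybrid time. -/
structure IsPerturbedArc {V : Type*} [NormedAddCommGroup V] [NormedSpace ℝ V] (S : Set (ℝ × ℕ))
    (F G : ℝ → ℕ → V → V) (D : ℝ) (b : ℝ × ℕ) (y : ℝ → ℕ → V) : Prop where
  dom : IsHybridTimeDomain S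
  arc : IsHybridArc S y
  nonneg : 0 ≤ D
  flow : ∀ k, ∀ᵐ s, s ∈ interior (timeSlice S k) → (s, k) ≤ b →
    ∃ d, ‖d‖ ≤ D ∧ HasDerivAt (fun r => y r k) (F s k (y s k) + d) s
  jump : ∀ k s, (s, k) ∈ jumpPoints S → (s, k + 1) ≤ b →
    ∃ d, ‖d‖ ≤ D ∧ y s (k + 1) = G s k (y s k) + d

section PerturbedArc

variable {V : Type*} [NormedAddCommGroup V] {S : Set (ℝ × ℕ)} {y f : ℝ → ℕ → V} {D : ℝ}
  {b : ℝ × ℕ}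

theorem IsPerturbedArc.of_hybridSupNorm [NormedSpace ℝ V] {F G : ℝ → ℕ → V → V}
    (hS : IsHybridTimeDomain S) (hy : IsHybridArc S y) (hf : hybridSupNorm S f b.1 b.2 ≠ ∞)
    (flow : ∀ k, ∀ᵐ s, s ∈ interior (timeSlice S k) → (s, k) ∉ jumpPoints S →
      HasDerivAt (fun r => y r k) (F s k (y s k) + f s k) s)
    (jump : ∀ k s, (s, k) ∈ jumpPoints S → y s (k + 1) = G s k (y s k) + f s k) :
    IsPerturbedArc S F G (hybridSupNorm S f b.1 b.2).toReal b y where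
  dom := hS
  arc := hy
  nonneg := ENNReal.toReal_nonneg
  flow k := by
    by_cases hk : k ≤ b.2
    · filter_upwards [flow k, hS.ae_enorm_le_hybridSupNorm (f := f) hk, hS.ae_notMem_jumpPoints k]
        with s hder hle hjump hmem hsb
      refine ⟨f s k, ?_, hder hmem hjump⟩
      simpa using ENNReal.toReal_mono hf (hle (mem_of_mem_interior_timeSlice hmem) hsb.1)
    · exact Filter.Eventually.of_forall fun s _ hsb => absurd hsb.2 hk
  jump k s hs hsb := by
    refine ⟨f s k, ?_, jump k s hs⟩
    have hle : ‖f s k‖ₑ ≤ hybridSupNorm S f b.1 b.2 :=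
      enorm_le_hybridSupNorm_of_mem_jumpPoints hs hsb.1 (k.le_succ.trans hsb.2)
    simpa using ENNReal.toReal_mono hf hle

variable [InnerProductSpace ℝ V] {lam r : ℝ}

theorem IsPerturbedArc.norm_sub_le_of_flow {G : ℝ → ℕ → V → V} {R : ℝ}
    (h : IsPerturbedArc S (fun _ _ y => -lam • y) G D b y) (hR : D ≤ lam * R) {k : ℕ} {s s' : ℝ}
    (hss : s ≤ s') (hsub : Icc s s' ⊆ timeSlice S k) (hsb : (s', k) ≤ b) :
    ‖y s' k‖ - R ≤ Real.exp (-lam * (s' - s)) * (‖y s k‖ - R) := by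
  have hnorm : IsHybridArc S fun s k => ‖y s k‖ - R :=
    h.arc.comp_lipschitz (L := fun y => ‖y‖ - R) (K := 1)
      (LipschitzWith.of_dist_le_mul fun x z => by simpa [dist_eq_norm] using dist_norm_norm_le x z)
  refine le_exp_mul_of_deriv_le_neg_mul (hnorm k s s' hss hsub) hss ?_
  filter_upwards [h.flow k] with q hq hmem
  obtain ⟨d, hd, hder⟩ := hq (Ioo_subset_interior_timeSlice hsub hmem)
    ⟨hmem.2.le.trans hsb.1, hsb.2⟩
  have hderiv : deriv (fun q => ‖y q k‖) q ≤ -lam * ‖y q k‖ + D := by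
    refine deriv_norm_le_of_inner_le hder ?_ fun h0 => by simpa [h0] using h.nonneg
    rw [inner_add_right, inner_smul_right, real_inner_self_eq_norm_sq]
    nlinarith [real_inner_le_norm (y q k) d, mul_le_mul_of_nonneg_left hd (norm_nonneg (y q k))]
  rw [deriv_sub_const]
  linarith

theorem IsPerturbedArc.norm_le_of_jump {F : ℝ → ℕ → V → V}
    (h : IsPerturbedArc S F (fun _ _ y => r • y) D b y) {k : ℕ} {s : ℝ}
    (hs : (s, k) ∈ jumpPoints S) (hsb : (s, k + 1) ≤ b) :
    ‖y s (k + 1)‖ ≤ |r| * ‖y s k‖ + D := by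
  obtain ⟨d, hd, heq⟩ := h.jump k s hs hsb
  rw [heq]
  refine (norm_add_le _ _).trans (add_le_add ?_ hd)
  rw [norm_smul, Real.norm_eq_abs]

theorem IsPerturbedArc.norm_le_exp_mul_add
    (h : IsPerturbedArc S (fun _ _ y => -lam • y) (fun _ _ y => r • y) D b y) (hb : b ∈ S)
    {l R : ℝ} (hlam : 0 < lam) (hl : l ≤ lam) (hr : |r| ≤ Real.exp (-l)) (hlamR : D ≤ lam * R)
    (hrR : D ≤ (1 - |r|) * R) :
    ‖y b.1 b.2‖ ≤ Real.exp (-l * (b.1 + b.2)) * ‖y 0 0‖ + R := by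
  refine h.dom.induction_on h.dom.zero_mem hb (h.dom.zero_le_of_mem hb)
    (Q := fun s k => ‖y s k‖ ≤ Real.exp (-l * (s + k)) * ‖y 0 0‖ + R) ?_ ?_ ?_
  · have hR : 0 ≤ R := nonneg_of_mul_nonneg_right (h.nonneg.trans hlamR) hlam
    simpa using hR
  · intro k s s' hss hsub _ hsb ih
    calc ‖y s' k‖ ≤ Real.exp (-lam * (s' - s)) * (‖y s k‖ - R) + R := by
          linarith [h.norm_sub_le_of_flow hlamR hss hsub hsb]
      _ ≤ Real.exp (-lam * (s' - s)) * (Real.exp (-l * (s + k)) * ‖y 0 0‖) + R := by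
          gcongr
          linarith
      _ ≤ Real.exp (-l * (s' - s)) * (Real.exp (-l * (s + k)) * ‖y 0 0‖) + R := by
          gcongr
      _ = Real.exp (-l * (s' + k)) * ‖y 0 0‖ + R := by
          rw [← mul_assoc, ← Real.exp_add]
          ring_nf
  · intro k s hs _ hsb ih
    calc ‖y s (k + 1)‖ ≤ |r| * ‖y s k‖ + D := h.norm_le_of_jump hs hsb
      _ ≤ |r| * (Real.exp (-l * (s + k)) * ‖y 0 0‖ + R) + (1 - |r|) * R := by gcongr
      _ = |r| * (Real.exp (-l * (s + k)) * ‖y 0 0‖) + R := by ring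
      _ ≤ Real.exp (-l) * (Real.exp (-l * (s + k)) * ‖y 0 0‖) + R := by gcongr
      _ = Real.exp (-l * (s + (k + 1 : ℕ))) * ‖y 0 0‖ + R := by
          rw [← mul_assoc, ← Real.exp_add]
          push_cast
          ring_nf

end PerturbedArc

/-! ### Optimisation over an auxiliary parameter -/

theorem le_sqrt_mul_of_forall {x α β : ℝ} (hβ : 0 < β) (h : ∀ c > 0, x ≤ α / (4 * c) + β * c) :
    x ≤ √(α * β) := by
  rcases le_or_gt x 0 with hx | hx
  · exact hx.trans (Real.sqrt_nonneg _)
  · have hopt := h (x / (2 * β)) (by positivity)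
    have hα : α / (4 * (x / (2 * β))) = α * β / (2 * x) := by
      field_simp
      norm_num
    have hβ' : β * (x / (2 * β)) = x / 2 := by field_simp
    rw [hα, hβ', ← sub_le_iff_le_add, le_div_iff₀ (by positivity)] at hopt
    exact (Real.le_sqrt' hx).2 (by linarith)

theorem sqrt_le_sqrt_add_sqrt_of_forall {A B Y : ℝ}
    (h : ∀ r > 0, A / (1 + r) ≤ Y + B / r) : √A ≤ √Y + √B := by
  by_contra! hlt
  obtain ⟨y, hy, hyA⟩ := exists_between (lt_sub_iff_add_lt.2 hlt)
  have hb : √B < √A - y := lt_sub_comm.1 hyA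
  set b := √A - y with hb_def
  have hy_pos : 0 < y := (Real.sqrt_nonneg Y).trans_lt hy
  have hb_pos : 0 < b := (Real.sqrt_nonneg B).trans_lt hb
  have hA : A = (y + b) ^ 2 := by
    have : 0 < √A := by linarith
    rw [hb_def, add_sub_cancel, Real.sq_sqrt (Real.sqrt_pos.1 this).le]
  have hleft : A / (1 + b / y) = y ^ 2 + b ^ 2 / (b / y) := by
    rw [hA]
    field_simp
  have hYy : Y < y ^ 2 := (Real.sqrt_lt' hy_pos).1 hy
  have hBb : B / (b / y) < b ^ 2 / (b / y) := by
    gcongr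
    exact (Real.sqrt_lt' hb_pos).1 hb
  linarith [h (b / y) (by positivity)]

theorem sq_div_one_add_le_of_le_add {x q w r : ℝ} (hx : 0 ≤ x) (hr : 0 < r) (h : x ≤ q + w) :
    x ^ 2 / (1 + r) ≤ q ^ 2 + w ^ 2 / r := by
  have hsq : (q ^ 2 + w ^ 2 / r) * (1 + r) - (q + w) ^ 2 = (r * q - w) ^ 2 / r := by
    field_simp
    ring
  have : 0 ≤ (r * q - w) ^ 2 / r := by positivity
  rw [div_le_iff₀ (by positivity)]
  linarith [pow_le_pow_left₀ hx h 2]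

/-! ### The gradient estimator -/

section GradientStep

variable {n p : ℕ}

/-- The normalized gain `1 / (γ + |M|²)` of the discrete-time gradient algorithm. -/
noncomputable def stepSize (γ : ℝ) (M : Matrix (Fin n) (Fin p) ℝ) : ℝ :=
  1 / (γ + specNorm M ^ 2)

/-- The continuous-time gradient algorithm for the estimation error `z` under the regressor `M`. -/
noncomputable def gradientFlow (γ : ℝ) (M : Matrix (Fin n) (Fin p) ℝ)
    (z : EuclideanSpace ℝ (Fin p)) : EuclideanSpace ℝ (Fin p) :=
  -(γ • mulE Mᵀ (mulE M z))

/-- The discrete-time, normalized gradient algorithm for the estimation error `z` under the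
regressor `M`. -/
noncomputable def gradientStep (γ : ℝ) (M : Matrix (Fin n) (Fin p) ℝ)
    (z : EuclideanSpace ℝ (Fin p)) : EuclideanSpace ℝ (Fin p) :=
  z - stepSize γ M • mulE Mᵀ (mulE M z)

variable {γ B D : ℝ} (M : Matrix (Fin n) (Fin p) ℝ) (z : EuclideanSpace ℝ (Fin p))
  {d : EuclideanSpace ℝ (Fin p)}

theorem stepSize_pos (hγ : 0 < γ) : 0 < stepSize γ M := by
  unfold stepSize
  positivity

theorem stepSize_mul_specNorm_sq_le_one (hγ : 0 < γ) : stepSize γ M * specNorm M ^ 2 ≤ 1 := by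
  rw [stepSize, one_div_mul_eq_div, div_le_one (by positivity)]
  linarith

theorem stepSize_mul_specNorm_le (hγ : 0 < γ) : stepSize γ M * specNorm M ≤ 1 / (2 * √γ) := by
  have := Real.sqrt_pos.2 hγ
  rw [stepSize, one_div_mul_eq_div, div_le_div_iff₀ (by positivity) (by positivity)]
  nlinarith [sq_nonneg (√γ - specNorm M), Real.sq_sqrt hγ.le]

variable {M} in
theorem one_div_add_sq_le_stepSize {ψM : ℝ} (hγ : 0 < γ) (hM : specNorm M ≤ ψM) :
    1 / (γ + ψM ^ 2) ≤ stepSize γ M := by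
  have := specNorm_nonneg M
  unfold stepSize
  gcongr

theorem inner_gradientFlow : inner ℝ z (gradientFlow γ M z) = -(γ * ‖mulE M z‖ ^ 2) := by
  rw [gradientFlow, inner_neg_right, inner_smul_right, inner_mulE_transpose,
    real_inner_self_eq_norm_sq]

theorem norm_gradientFlow_le {ψM : ℝ} (hγ : 0 ≤ γ) (hM : specNorm M ≤ ψM) :
    ‖gradientFlow γ M z‖ ≤ γ * ψM * ‖mulE M z‖ := by
  rw [gradientFlow, norm_neg, norm_smul, Real.norm_of_nonneg hγ, mul_assoc]
  gcongr
  exact (norm_mulE_transpose_le _ _).trans (by gcongr)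

theorem norm_gradientStep_sub_le (hγ : 0 < γ) :
    ‖gradientStep γ M z - z‖ ≤ stepSize γ M * (specNorm M * ‖mulE M z‖) := by
  rw [gradientStep, sub_sub_cancel_left, norm_neg, norm_smul,
    Real.norm_of_nonneg (stepSize_pos M hγ).le]
  gcongr
  · exact (stepSize_pos M hγ).le
  · exact norm_mulE_transpose_le _ _

theorem norm_gradientStep_sq_le (hγ : 0 < γ) :
    ‖gradientStep γ M z‖ ^ 2 ≤ ‖z‖ ^ 2 - stepSize γ M * ‖mulE M z‖ ^ 2 := by
  have hβ := stepSize_pos M hγ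
  have hcross : inner ℝ z (gradientStep γ M z - z) = -(stepSize γ M * ‖mulE M z‖ ^ 2) := by
    rw [gradientStep, sub_sub_cancel_left, inner_neg_right, inner_smul_right, inner_mulE_transpose,
      real_inner_self_eq_norm_sq]
  have hincr : ‖gradientStep γ M z - z‖ ^ 2 ≤ stepSize γ M * ‖mulE M z‖ ^ 2 := by
    calc ‖gradientStep γ M z - z‖ ^ 2 ≤ (stepSize γ M * (specNorm M * ‖mulE M z‖)) ^ 2 := by
          gcongr
          exact norm_gradientStep_sub_le M z hγ
      _ = stepSize γ M * specNorm M ^ 2 * (stepSize γ M * ‖mulE M z‖ ^ 2) := by ring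
      _ ≤ 1 * (stepSize γ M * ‖mulE M z‖ ^ 2) := by
          gcongr
          exact stepSize_mul_specNorm_sq_le_one M hγ
      _ = stepSize γ M * ‖mulE M z‖ ^ 2 := one_mul _
  have hexpand := norm_add_sq_real z (gradientStep γ M z - z)
  rw [add_sub_cancel, hcross] at hexpand
  linarith

theorem norm_gradientStep_le (hγ : 0 < γ) : ‖gradientStep γ M z‖ ≤ ‖z‖ := by
  refine le_of_sq_le_sq ((norm_gradientStep_sq_le M z hγ).trans ?_) (norm_nonneg z)
  have := stepSize_pos M hγ
  exact sub_le_self _ (by positivity)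

variable {z}

theorem two_mul_inner_gradientFlow_add_le (hz : ‖z‖ ≤ B) (hd : ‖d‖ ≤ D) :
    2 * inner ℝ z (gradientFlow γ M z + d)
      ≤ -(2 * γ) * ‖mulE M z‖ ^ 2 + (2 * D * B + D ^ 2) := by
  have hcross : inner ℝ z d ≤ B * D :=
    (real_inner_le_norm z d).trans (by gcongr; exact (norm_nonneg z).trans hz)
  rw [inner_add_right, inner_gradientFlow]
  nlinarith

theorem norm_gradientStep_add_sq_le (hγ : 0 < γ) (hz : ‖z‖ ≤ B) (hd : ‖d‖ ≤ D) :
    ‖gradientStep γ M z + d‖ ^ 2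
      ≤ ‖z‖ ^ 2 - stepSize γ M * ‖mulE M z‖ ^ 2 + (2 * D * B + D ^ 2) := by
  have hcross : inner ℝ (gradientStep γ M z) d ≤ B * D :=
    (real_inner_le_norm _ d).trans (by
      gcongr
      · exact (norm_nonneg z).trans hz
      · exact (norm_gradientStep_le M z hγ).trans hz)
  have hd_sq : ‖d‖ ^ 2 ≤ D ^ 2 := by gcongr
  rw [norm_add_sq_real]
  linarith [norm_gradientStep_sq_le M z hγ]

section Excursion

variable {c K : ℝ}

/-- Completing the square in `‖M z‖` turns a bound on the speed into one by the dissipation. -/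
theorem norm_gradientFlow_add_add_le {ψM : ℝ} (hγ : 0 ≤ γ) (hM : specNorm M ≤ ψM) (hc : 0 < c)
    (hK : γ * ψM ^ 2 ≤ 4 * c * K) (hz : ‖z‖ ≤ B) (hd : ‖d‖ ≤ D) :
    ‖gradientFlow γ M z + d‖ + K * (2 * inner ℝ z (gradientFlow γ M z + d))
      ≤ c / 2 + D + K * (2 * D * B + D ^ 2) := by
  set q := ‖mulE M z‖
  have hK_nonneg : 0 ≤ K :=
    nonneg_of_mul_nonneg_right ((by positivity : 0 ≤ γ * ψM ^ 2).trans hK) (by positivity)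
  have hspeed : ‖gradientFlow γ M z + d‖ ≤ γ * ψM * q + D :=
    (norm_add_le _ _).trans (add_le_add (norm_gradientFlow_le M z hγ hM) hd)
  have hsquare : 2 * c * (γ * ψM * q) ≤ c ^ 2 + γ * ψM ^ 2 * (γ * q ^ 2) := by
    linarith [sq_nonneg (c - γ * ψM * q)]
  have hdissipation : γ * ψM ^ 2 * (γ * q ^ 2) ≤ 4 * c * K * (γ * q ^ 2) := by gcongr
  have hbalance : γ * ψM * q ≤ c / 2 + K * (2 * γ * q ^ 2) :=
    le_of_mul_le_mul_left (by linarith) (by positivity : 0 < 2 * c)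
  linarith [mul_le_mul_of_nonneg_left (two_mul_inner_gradientFlow_add_le M (γ := γ) hz hd)
    hK_nonneg]

theorem norm_gradientStep_add_sub_add_le (hγ : 0 < γ) (hc : 0 < c) (hK : 1 ≤ 2 * c * K)
    (hz : ‖z‖ ≤ B) (hd : ‖d‖ ≤ D) :
    ‖gradientStep γ M z + d - z‖ + K * ‖gradientStep γ M z + d‖ ^ 2
      ≤ K * ‖z‖ ^ 2 + (c / 2 + D + K * (2 * D * B + D ^ 2)) := by
  set q := ‖mulE M z‖
  set w := specNorm M
  set β := stepSize γ M
  have hβ : 0 < β := stepSize_pos M hγ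
  have hK_nonneg : 0 ≤ K :=
    nonneg_of_mul_nonneg_right (zero_le_one.trans hK) (by positivity)
  have hincr : ‖gradientStep γ M z + d - z‖ ≤ β * (w * q) + D := by
    rw [add_sub_right_comm]
    exact (norm_add_le _ _).trans (add_le_add (norm_gradientStep_sub_le M z hγ) hd)
  have hsquare : 2 * c * (β * (w * q)) ≤ c ^ 2 + β * w ^ 2 * (β * q ^ 2) := by
    linarith [sq_nonneg (c - β * (w * q))]
  have hdissipation : β * w ^ 2 * (β * q ^ 2) ≤ 2 * c * K * (β * q ^ 2) :=
    mul_le_mul_of_nonneg_right ((stepSize_mul_specNorm_sq_le_one M hγ).trans hK) (by positivity)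
  have hbalance : β * (w * q) ≤ c / 2 + K * (β * q ^ 2) :=
    le_of_mul_le_mul_left (by linarith) (by positivity : 0 < 2 * c)
  linarith [mul_le_mul_of_nonneg_left (norm_gradientStep_add_sq_le M hγ hz hd) hK_nonneg]

end Excursion

section Excitation

variable {v : EuclideanSpace ℝ (Fin p)} {m r δ : ℝ}

theorem norm_mulE_sq_div_one_add_le (hr : 0 < r) (hδ : ‖z - v‖ ≤ δ) :
    ‖mulE M v‖ ^ 2 / (1 + r) ≤ ‖mulE M z‖ ^ 2 + (specNorm M * δ) ^ 2 / r := by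
  refine sq_div_one_add_le_of_le_add (norm_nonneg _) hr ?_
  calc ‖mulE M v‖ = ‖mulE M z - mulE M (z - v)‖ := by rw [mulE_sub, sub_sub_cancel]
    _ ≤ ‖mulE M z‖ + specNorm M * ‖z - v‖ :=
        (norm_sub_le _ _).trans (add_le_add le_rfl (norm_mulE_le _ _))
    _ ≤ ‖mulE M z‖ + specNorm M * δ := by
        have := specNorm_nonneg M
        gcongr

theorem two_mul_inner_gradientFlow_add_le_of_norm_sub_le {ψM : ℝ} (hγ : 0 ≤ γ)
    (hM : specNorm M ≤ ψM) (hm : m ≤ γ) (hr : 0 < r) (hδ : ‖z - v‖ ≤ δ) (hz : ‖z‖ ≤ B)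
    (hd : ‖d‖ ≤ D) :
    2 * inner ℝ z (gradientFlow γ M z + d)
      ≤ -(2 / (1 + r) * m) * ‖mulE M v‖ ^ 2
        + (2 / r * (γ * ψM ^ 2 * δ ^ 2) + (2 * D * B + D ^ 2)) := by
  have hM_nonneg := specNorm_nonneg M
  have hδ_nonneg := (norm_nonneg _).trans hδ
  have hv : 2 * γ * (‖mulE M v‖ ^ 2 / (1 + r))
      ≤ 2 * γ * (‖mulE M z‖ ^ 2 + (ψM * δ) ^ 2 / r) := by
    gcongr
    exact (norm_mulE_sq_div_one_add_le M hr hδ).trans (by gcongr)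
  have hgain : 2 * m * (‖mulE M v‖ ^ 2 / (1 + r)) ≤ 2 * γ * (‖mulE M v‖ ^ 2 / (1 + r)) := by
    gcongr
  calc 2 * inner ℝ z (gradientFlow γ M z + d)
      ≤ -(2 * γ) * ‖mulE M z‖ ^ 2 + (2 * D * B + D ^ 2) :=
        two_mul_inner_gradientFlow_add_le M hz hd
    _ ≤ -(2 * m * (‖mulE M v‖ ^ 2 / (1 + r))) + 2 * γ * ((ψM * δ) ^ 2 / r)
          + (2 * D * B + D ^ 2) := by linarith
    _ = _ := by ring

theorem norm_gradientStep_add_sq_le_of_norm_sub_le (hγ : 0 < γ) (hm : 2 * m ≤ stepSize γ M)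
    (hr : 0 < r) (hδ : ‖z - v‖ ≤ δ) (hz : ‖z‖ ≤ B) (hd : ‖d‖ ≤ D) :
    ‖gradientStep γ M z + d‖ ^ 2
      ≤ ‖z‖ ^ 2 - 2 / (1 + r) * m * ‖mulE M v‖ ^ 2 + (δ ^ 2 / r + (2 * D * B + D ^ 2)) := by
  set β := stepSize γ M
  have hβ : 0 < β := stepSize_pos M hγ
  have hv : β * (‖mulE M v‖ ^ 2 / (1 + r))
      ≤ β * (‖mulE M z‖ ^ 2 + (specNorm M * δ) ^ 2 / r) := by
    gcongr
    exact norm_mulE_sq_div_one_add_le M hr hδ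
  have hgain : 2 * m * (‖mulE M v‖ ^ 2 / (1 + r)) ≤ β * (‖mulE M v‖ ^ 2 / (1 + r)) := by
    gcongr
  have hstep : β * specNorm M ^ 2 * (δ ^ 2 / r) ≤ 1 * (δ ^ 2 / r) := by
    gcongr
    exact stepSize_mul_specNorm_sq_le_one M hγ
  calc ‖gradientStep γ M z + d‖ ^ 2
      ≤ ‖z‖ ^ 2 - β * ‖mulE M z‖ ^ 2 + (2 * D * B + D ^ 2) :=
        norm_gradientStep_add_sq_le M hγ hz hd
    _ ≤ ‖z‖ ^ 2 - 2 * m * (‖mulE M v‖ ^ 2 / (1 + r)) + β * ((specNorm M * δ) ^ 2 / r)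
          + (2 * D * B + D ^ 2) := by linarith
    _ = ‖z‖ ^ 2 - 2 / (1 + r) * m * ‖mulE M v‖ ^ 2
          + (β * specNorm M ^ 2 * (δ ^ 2 / r) + (2 * D * B + D ^ 2)) := by ring
    _ ≤ _ := by linarith

end Excitation

end GradientStep

theorem IsPerturbedArc.le_add_hybridIntegral {V : Type*} [NormedAddCommGroup V] [NormedSpace ℝ V]
    {S : Set (ℝ × ℕ)} {F G : ℝ → ℕ → V → V} {D C : ℝ} {b : ℝ × ℕ} {y : ℝ → ℕ → V}
    (h : IsPerturbedArc S F G D b y) {W : V → ℝ} (hW : IsHybridArc S fun s k => W (y s k))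
    {a c : ℝ × ℕ} (ha : a ∈ S) (hc : c ∈ S) (hac : a ≤ c) (hcb : c ≤ b) {f : ℝ → ℕ → ℝ}
    (hf : IsSlicewiseContinuous S f)
    (flow : ∀ k s d, (s, k) ∈ S → a ≤ (s, k) → (s, k) ≤ c → ‖d‖ ≤ D →
      HasDerivAt (fun r => y r k) (F s k (y s k) + d) s →
      DifferentiableAt ℝ (fun r => W (y r k)) s → deriv (fun r => W (y r k)) s ≤ f s k + C)
    (jump : ∀ k s d, (s, k) ∈ S → (s, k + 1) ∈ S → a ≤ (s, k) → (s, k) ≤ c → ‖d‖ ≤ D →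
      W (G s k (y s k) + d) ≤ W (y s k) + f s (k + 1) + C) :
    W (y c.1 c.2) ≤ W (y a.1 a.2) + hybridIntegral S f a c + C * elapsedTime a c := by
  refine hW.le_add_hybridIntegral h.dom ha hc hac hf (fun k => ?_) fun k s hs has hsc => ?_
  · filter_upwards [h.flow k] with s hs hmem has hsc hdiff
    obtain ⟨d, hd, hder⟩ := hs hmem (hsc.trans hcb)
    exact flow k s d (mem_of_mem_interior_timeSlice hmem) has hsc hd hder hdiff
  · obtain ⟨d, hd, heq⟩ := h.jump k s hs (hsc.trans hcb)
    rw [heq]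
    exact jump k s d hs.1 hs.2 has ((Prod.mk_le_mk.2 ⟨le_rfl, k.le_succ⟩).trans hsc) hd

/-- An arc of the estimation error of the hybrid gradient algorithm with regressor `ψ`, with
additive perturbations bounded by `D` up to the horizon `b`. -/
structure IsPerturbedGradientArc {n p : ℕ} (S : Set (ℝ × ℕ))
    (ψ : ℝ → ℕ → Matrix (Fin n) (Fin p) ℝ) (γc γd ψM D : ℝ) (b : ℝ × ℕ)
    (z : ℝ → ℕ → EuclideanSpace ℝ (Fin p)) : Prop
    extends IsPerturbedArc S (fun s k => gradientFlow γc (ψ s k))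
      (fun s k => gradientStep γd (ψ s (k + 1))) D b z where
  γc_pos : 0 < γc
  γd_pos : 0 < γd
  continuous : IsSlicewiseContinuous S ψ
  bound : ∀ s k, (s, k) ∈ S → specNorm (ψ s k) ≤ ψM

theorem IsHybridArc.norm_sq {V : Type*} [NormedAddCommGroup V] {S : Set (ℝ × ℕ)} {y : ℝ → ℕ → V}
    (hy : IsHybridArc S y) : IsHybridArc S fun s k => ‖y s k‖ ^ 2 := by
  have hnorm : IsHybridArc S fun s k => ‖y s k‖ := hy.comp_lipschitz lipschitzWith_one_norm
  intro k s t hst hsub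
  simpa only [sq] using (hnorm k s t hst hsub).fun_mul (hnorm k s t hst hsub)

theorem IsHybridArc.norm_sub_const {V : Type*} [NormedAddCommGroup V] {S : Set (ℝ × ℕ)}
    {y : ℝ → ℕ → V} (hy : IsHybridArc S y) (v : V) : IsHybridArc S fun s k => ‖y s k - v‖ :=
  hy.comp_lipschitz (L := fun x => ‖x - v‖) (K := 1) (LipschitzWith.of_dist_le_mul fun x x' => by
    simpa [dist_eq_norm] using dist_norm_norm_le (x - v) (x' - v))

namespace IsPerturbedGradientArc

variable {n p : ℕ} {S : Set (ℝ × ℕ)} {z : ℝ → ℕ → EuclideanSpace ℝ (Fin p)}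
  {ψ : ℝ → ℕ → Matrix (Fin n) (Fin p) ℝ} {γc γd ψM D : ℝ} {a b c : ℝ × ℕ}

theorem norm_le (h : IsPerturbedGradientArc S ψ γc γd ψM D b z) (ha : a ∈ S) (hc : c ∈ S)
    (hac : a ≤ c) (hcb : c ≤ b) : ‖z c.1 c.2‖ ≤ ‖z a.1 a.2‖ + D * elapsedTime a c := by
  have key := h.le_add_hybridIntegral (W := fun x => ‖x‖)
    (h.arc.comp_lipschitz lipschitzWith_one_norm) ha hc hac hcb
    (f := fun _ _ => 0) (C := D) (fun _ _ _ _ => continuousOn_const) ?_ ?_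
  · simpa using key
  · intro k s d _ _ _ hd hder _
    rw [zero_add]
    refine deriv_norm_le_of_inner_le hder ?_ fun _ => h.nonneg
    have hγ := h.γc_pos
    have : 0 ≤ γc * ‖mulE (ψ s k) (z s k)‖ ^ 2 := by positivity
    rw [inner_add_right, inner_gradientFlow]
    nlinarith [real_inner_le_norm (z s k) d, mul_le_mul_of_nonneg_left hd (norm_nonneg (z s k))]
  · intro k s d _ _ _ _ hd
    rw [add_zero]
    exact (norm_add_le _ _).trans (add_le_add (norm_gradientStep_le _ _ h.γd_pos) hd)

variable {B : ℝ}

theorem norm_sq_le (h : IsPerturbedGradientArc S ψ γc γd ψM D b z) (ha : a ∈ S) (hc : c ∈ S)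
    (hac : a ≤ c) (hcb : c ≤ b)
    (hB : ∀ s k, (s, k) ∈ S → a ≤ (s, k) → (s, k) ≤ c → ‖z s k‖ ≤ B) :
    ‖z c.1 c.2‖ ^ 2 ≤ ‖z a.1 a.2‖ ^ 2 + (2 * D * B + D ^ 2) * elapsedTime a c := by
  have key := h.le_add_hybridIntegral (W := fun x => ‖x‖ ^ 2) h.arc.norm_sq ha hc hac hcb
    (f := fun _ _ => 0) (C := 2 * D * B + D ^ 2) (fun _ _ _ _ => continuousOn_const) ?_ ?_
  · simpa using key
  · intro k s d hs has hsc hd hder _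
    rw [hder.norm_sq.deriv, zero_add]
    refine (two_mul_inner_gradientFlow_add_le _ (hB s k hs has hsc) hd).trans ?_
    have hγ := h.γc_pos
    have : 0 ≤ 2 * γc * ‖mulE (ψ s k) (z s k)‖ ^ 2 := by positivity
    linarith
  · intro k s d hs _ has hsc hd
    have hzB := hB s k hs has hsc
    refine (norm_gradientStep_add_sq_le _ h.γd_pos hzB hd).trans ?_
    have hβ := stepSize_pos (ψ s (k + 1)) h.γd_pos
    have : 0 ≤ stepSize γd (ψ s (k + 1)) * ‖mulE (ψ s (k + 1)) (z s k)‖ ^ 2 := by positivity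
    linarith

/-- The dissipation of `‖z‖²` pays for the motion of `z`. -/
theorem excursion_le (h : IsPerturbedGradientArc S ψ γc γd ψM D b z) (ha : a ∈ S) (hc : c ∈ S)
    (hac : a ≤ c) (hcb : c ≤ b)
    (hB : ∀ s k, (s, k) ∈ S → a ≤ (s, k) → (s, k) ≤ c → ‖z s k‖ ≤ B) {e K : ℝ} (he : 0 < e)
    (hKc : γc * ψM ^ 2 ≤ 4 * e * K) (hKd : 1 ≤ 2 * e * K) :
    ‖z c.1 c.2 - z a.1 a.2‖ + K * ‖z c.1 c.2‖ ^ 2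
      ≤ K * ‖z a.1 a.2‖ ^ 2 + (e / 2 + D + K * (2 * D * B + D ^ 2)) * elapsedTime a c := by
  set v := z a.1 a.2 with hv
  have hW : IsHybridArc S fun s k => ‖z s k - v‖ + K * ‖z s k‖ ^ 2 := fun k s t hst hsub =>
    (h.arc.norm_sub_const v k s t hst hsub).fun_add ((h.arc.norm_sq k s t hst hsub).const_mul K)
  have key := h.le_add_hybridIntegral (W := fun x => ‖x - v‖ + K * ‖x‖ ^ 2) hW ha hc hac hcb
    (f := fun _ _ => 0) (C := e / 2 + D + K * (2 * D * B + D ^ 2))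
    (fun _ _ _ _ => continuousOn_const) ?_ ?_
  · simpa [← hv] using key
  · intro k s d hs has hsc hd hder hdiff
    have hsq := hder.norm_sq.const_mul K
    have hdist : DifferentiableAt ℝ (fun r => ‖z r k - v‖) s := by
      simpa using hdiff.fun_sub hsq.differentiableAt
    have hspeed : deriv (fun r => ‖z r k - v‖) s ≤ ‖gradientFlow γc (ψ s k) (z s k) + d‖ :=
      deriv_norm_le_of_inner_le (hder.sub_const v)
        ((real_inner_le_norm _ _).trans_eq (mul_comm _ _)) fun _ => norm_nonneg _
    rw [(hdist.hasDerivAt.fun_add hsq).deriv, zero_add]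
    exact (add_le_add hspeed le_rfl).trans (norm_gradientFlow_add_add_le _ h.γc_pos.le
      (h.bound s k hs) he hKc (hB s k hs has hsc) hd)
  · intro k s d hs _ has hsc hd
    have hzB := hB s k hs has hsc
    have htriangle := norm_sub_le_norm_sub_add_norm_sub
      (gradientStep γd (ψ s (k + 1)) (z s k) + d) (z s k) v
    linarith [norm_gradientStep_add_sub_add_le (ψ s (k + 1)) h.γd_pos he hKd hzB hd]

theorem norm_sq_le_of_excitation (h : IsPerturbedGradientArc S ψ γc γd ψM D b z) (ha : a ∈ S)
    (hc : c ∈ S) (hac : a ≤ c) (hcb : c ≤ b)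
    (hB : ∀ s k, (s, k) ∈ S → a ≤ (s, k) → (s, k) ≤ c → ‖z s k‖ ≤ B) {δ μ r : ℝ}
    (hδ : ∀ s k, (s, k) ∈ S → a ≤ (s, k) → (s, k) ≤ c → ‖z s k - z a.1 a.2‖ ≤ δ)
    (hμ : (excitation S ψ a c - μ • (1 : Matrix (Fin p) (Fin p) ℝ)).PosSemidef) (hr : 0 < r) :
    ‖z c.1 c.2‖ ^ 2 ≤ ‖z a.1 a.2‖ ^ 2
      - 2 / (1 + r) * (min γc (1 / (2 * (γd + ψM ^ 2))) * (μ * ‖z a.1 a.2‖ ^ 2))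
      + (2 / r * ((γc * ψM ^ 2 + 1 / 2) * δ ^ 2) + (2 * D * B + D ^ 2)) * elapsedTime a c := by
  have hγc := h.γc_pos
  have hγd := h.γd_pos
  set v := z a.1 a.2
  set m := min γc (1 / (2 * (γd + ψM ^ 2)))
  have key := h.le_add_hybridIntegral (W := fun x => ‖x‖ ^ 2) h.arc.norm_sq ha hc hac hcb
    (f := fun s k => -(2 / (1 + r) * m) * ‖mulE (ψ s k) v‖ ^ 2)
    (C := 2 / r * ((γc * ψM ^ 2 + 1 / 2) * δ ^ 2) + (2 * D * B + D ^ 2))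
    (fun k s t hsub => (h.continuous.norm_mulE_sq v k s t hsub).const_mul _) ?_ ?_
  · rw [hybridIntegral_const_mul] at key
    have hloss : 2 / (1 + r) * m * (μ * ‖v‖ ^ 2)
        ≤ 2 / (1 + r) * m * hybridIntegral S (fun s k => ‖mulE (ψ s k) v‖ ^ 2) a c := by
      gcongr
      exact mul_norm_sq_le_hybridIntegral h.dom h.continuous hc hμ v
    linarith
  · intro k s d hs has hsc hd hder _
    rw [hder.norm_sq.deriv]
    have : 0 ≤ 2 / r * (1 / 2 * δ ^ 2) := by positivity
    linarith [two_mul_inner_gradientFlow_add_le_of_norm_sub_le (ψ s k) hγc.le (h.bound s k hs)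
      (min_le_left γc _ : m ≤ γc) hr (hδ s k hs has hsc) (hB s k hs has hsc) hd]
  · intro k s d hs hs' has hsc hd
    have hm : 2 * m ≤ stepSize γd (ψ s (k + 1)) := by
      refine le_trans ?_ (one_div_add_sq_le_stepSize hγd (h.bound s (k + 1) hs'))
      calc 2 * m ≤ 2 * (1 / (2 * (γd + ψM ^ 2))) := by
            gcongr
            exact min_le_right _ _
        _ = 1 / (γd + ψM ^ 2) := by field_simp
    have : 0 ≤ 2 / r * (γc * ψM ^ 2 * δ ^ 2) := by positivity
    have hhalf : 2 / r * (1 / 2 * δ ^ 2) = δ ^ 2 / r := by ring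
    linarith [norm_gradientStep_add_sq_le_of_norm_sub_le (ψ s (k + 1)) hγd hm hr
      (hδ s k hs has hsc) (hB s k hs has hsc) hd]

end IsPerturbedGradientArc

/-! ### Contraction over a window of excitation -/

theorem le_sqrt_mul_add_of_loss {m x δ Y σ : ℝ} (hm : 0 ≤ m) (hδ : 0 ≤ δ) (hσ : 0 ≤ σ)
    (hσ1 : σ < 1) (hY : 0 ≤ Y) (hloss : Y ≤ m ^ 2 - x ^ 2 + 2 * δ * m + 3 * δ ^ 2)
    (h : √σ * m ≤ √Y + δ) : x ≤ √(1 - σ) * m + 3 / √(1 - σ) * δ := by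
  have ht_sq : √(1 - σ) ^ 2 = 1 - σ := Real.sq_sqrt (by linarith)
  have hu_sq : √σ ^ 2 = σ := Real.sq_sqrt hσ
  have ht_pos : 0 < √(1 - σ) := Real.sqrt_pos.2 (by linarith)
  have ht_le : √(1 - σ) ≤ 1 := Real.sqrt_le_one.2 (by linarith)
  have hu_le : √σ ≤ 1 := Real.sqrt_le_one.2 hσ1.le
  have hu_nonneg : 0 ≤ √σ := Real.sqrt_nonneg σ
  set t := √(1 - σ)
  set u := √σ
  have hδ_div : 3 * δ ≤ 3 / t * δ := by
    gcongr
    rw [le_div_iff₀ ht_pos]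
    linarith
  rcases le_or_gt δ (u * m) with hlarge | hsmall
  · have hY_ge : (u * m - δ) ^ 2 ≤ Y := by
      rw [← Real.sq_sqrt hY]
      gcongr
      linarith
    have hcross : u * (m * δ) ≤ 1 * (m * δ) := by gcongr
    have hexpand : (t * m + 3 / t * δ) ^ 2 = t ^ 2 * m ^ 2 + 6 * m * δ + (3 / t * δ) ^ 2 := by
      field_simp
      ring
    have : (3 * δ) ^ 2 ≤ (3 / t * δ) ^ 2 := by gcongr
    refine le_of_sq_le_sq ?_ (by positivity)
    rw [hexpand, ht_sq, ← hu_sq]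
    nlinarith [mul_nonneg hm hδ, sq_nonneg δ]
  · have hx : x ≤ m + 2 * δ :=
      le_of_sq_le_sq (by nlinarith [mul_nonneg hm hδ, sq_nonneg δ]) (by positivity)
    have hm_small : (1 - t) * m ≤ δ := by
      calc (1 - t) * m ≤ u ^ 2 * m := by
            gcongr
            nlinarith
        _ = u * (u * m) := by ring
        _ ≤ 1 * δ := mul_le_mul hu_le hsmall.le (by positivity) zero_le_one
        _ = δ := one_mul δ
    linarith

theorem sqrt_mul_le_of_excited {m Y K σ δ μ Q R : ℝ} (hm : 0 ≤ m) (hY : 0 ≤ Y) (hδ : 0 ≤ δ)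
    (hσ : 0 ≤ σ) (hK : 0 ≤ K) (hσμ : σ * (1 + K) ^ 2 ≤ μ) (hR : 0 ≤ R)
    (hRK : R ≤ K ^ 2) (hRQ : R * Q ≤ K ^ 2) (h : √μ * m ≤ √Y + √R * (√(Q * Y) + δ)) :
    √σ * m ≤ √Y + δ := by
  have hσμ_sqrt : √σ * (1 + K) ≤ √μ := by
    refine Real.le_sqrt_of_sq_le ?_
    rwa [mul_pow, Real.sq_sqrt hσ]
  have hRQ_sqrt : √R * √(Q * Y) ≤ K * √Y := by
    rw [← Real.sqrt_mul hR, ← mul_assoc, Real.sqrt_mul' _ hY]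
    gcongr
    exact Real.sqrt_le_iff.2 ⟨hK, hRQ⟩
  refine le_of_mul_le_mul_right ?_ (by positivity : 0 < 1 + K)
  calc √σ * m * (1 + K) = √σ * (1 + K) * m := by ring
    _ ≤ √μ * m := by gcongr
    _ ≤ √Y + √R * √(Q * Y) + √R * δ := by linarith
    _ ≤ √Y + K * √Y + K * δ := by
        gcongr
        exact Real.sqrt_le_iff.2 ⟨hK, hRK⟩
    _ ≤ (√Y + δ) * (1 + K) := by linarith

namespace IsPerturbedGradientArc

variable {n p : ℕ} {S : Set (ℝ × ℕ)} {z : ℝ → ℕ → EuclideanSpace ℝ (Fin p)}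
  {ψ : ℝ → ℕ → Matrix (Fin n) (Fin p) ℝ} {γc γd ψM D B ℓ : ℝ} {a b c : ℝ × ℕ}

theorem norm_sub_le_of_elapsedTime_le (h : IsPerturbedGradientArc S ψ γc γd ψM D b z)
    (ha : a ∈ S) (hc : c ∈ S) (hcb : c ≤ b)
    (hB : ∀ s k, (s, k) ∈ S → a ≤ (s, k) → (s, k) ≤ c → ‖z s k‖ ≤ B) (hB0 : 0 ≤ B)
    (hℓ : 0 < ℓ) (hlen : elapsedTime a c ≤ ℓ) {s : ℝ} {k : ℕ} (hs : (s, k) ∈ S)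
    (has : a ≤ (s, k)) (hsc : (s, k) ≤ c) :
    ‖z s k - z a.1 a.2‖ ≤ √((γc * ψM ^ 2 + 2) * (ℓ / 2) * (‖z a.1 a.2‖ ^ 2 - ‖z c.1 c.2‖ ^ 2
      + (2 * D * B + D ^ 2) * ℓ)) + ℓ * D := by
  have hD := h.nonneg
  have hγc := h.γc_pos
  rw [← sub_le_iff_le_add, mul_right_comm]
  refine le_sqrt_mul_of_forall (by positivity) fun r hr => ?_
  have hexcursion := h.excursion_le ha hs has (hsc.trans hcb)
    (fun s' k' hs' has' hse => hB s' k' hs' has' (hse.trans hsc)) hr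
    (K := (γc * ψM ^ 2 + 2) / (4 * r)) (by field_simp; linarith)
    (by field_simp; linarith [mul_nonneg hγc.le (sq_nonneg ψM)])
  have hremaining := h.norm_sq_le hs hc hsc hcb fun s' k' hs' hes => hB s' k' hs' (has.trans hes)
  have hloss : ‖z a.1 a.2‖ ^ 2 - ‖z s k‖ ^ 2 + (2 * D * B + D ^ 2) * elapsedTime a (s, k)
      ≤ ‖z a.1 a.2‖ ^ 2 - ‖z c.1 c.2‖ ^ 2 + (2 * D * B + D ^ 2) * ℓ := by
    have : (2 * D * B + D ^ 2) * elapsedTime a c ≤ (2 * D * B + D ^ 2) * ℓ := by gcongr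
    rw [← elapsedTime_add_elapsedTime a (s, k) c] at this
    linarith
  have hdrift : (r / 2 + D) * elapsedTime a (s, k) ≤ (r / 2 + D) * ℓ := by
    gcongr
    exact (elapsedTime_le_of_le hsc).trans hlen
  have := mul_le_mul_of_nonneg_left hloss (by positivity : 0 ≤ (γc * ψM ^ 2 + 2) / (4 * r))
  rw [mul_div_right_comm]
  linarith

theorem sqrt_mul_norm_le_of_excitation (h : IsPerturbedGradientArc S ψ γc γd ψM D b z)
    (ha : a ∈ S) (hc : c ∈ S) (hac : a ≤ c) (hcb : c ≤ b)
    (hB : ∀ s k, (s, k) ∈ S → a ≤ (s, k) → (s, k) ≤ c → ‖z s k‖ ≤ B) (hB0 : 0 ≤ B)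
    (hlen : elapsedTime a c ≤ ℓ) {δ μ : ℝ} (hδ0 : 0 ≤ δ)
    (hδ : ∀ s k, (s, k) ∈ S → a ≤ (s, k) → (s, k) ≤ c → ‖z s k - z a.1 a.2‖ ≤ δ)
    (hμ : (excitation S ψ a c - μ • (1 : Matrix (Fin p) (Fin p) ℝ)).PosSemidef) :
    √(2 * (min γc (1 / (2 * (γd + ψM ^ 2))) * μ)) * ‖z a.1 a.2‖
      ≤ √(‖z a.1 a.2‖ ^ 2 - ‖z c.1 c.2‖ ^ 2 + (2 * D * B + D ^ 2) * ℓ)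
        + √(2 * ℓ * (γc * ψM ^ 2 + 1 / 2)) * δ := by
  have hD := h.nonneg
  have hγc := h.γc_pos
  have hopt := sqrt_le_sqrt_add_sqrt_of_forall
    (A := 2 * (min γc (1 / (2 * (γd + ψM ^ 2))) * μ) * ‖z a.1 a.2‖ ^ 2)
    (B := 2 * ℓ * (γc * ψM ^ 2 + 1 / 2) * δ ^ 2)
    (Y := ‖z a.1 a.2‖ ^ 2 - ‖z c.1 c.2‖ ^ 2 + (2 * D * B + D ^ 2) * ℓ) fun r hr => by
      have hdecay := h.norm_sq_le_of_excitation ha hc hac hcb hB hδ hμ hr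
      have : (2 / r * ((γc * ψM ^ 2 + 1 / 2) * δ ^ 2) + (2 * D * B + D ^ 2)) * elapsedTime a c
          ≤ (2 / r * ((γc * ψM ^ 2 + 1 / 2) * δ ^ 2) + (2 * D * B + D ^ 2)) * ℓ := by gcongr
      linear_combination hdecay + this
  rwa [Real.sqrt_mul' _ (sq_nonneg _), Real.sqrt_sq (norm_nonneg _), Real.sqrt_mul' _ (sq_nonneg _),
    Real.sqrt_sq hδ0] at hopt

theorem norm_le_sqrt_mul_add_of_excitation (h : IsPerturbedGradientArc S ψ γc γd ψM D b z)
    (ha : a ∈ S) (hc : c ∈ S) (hac : a ≤ c) (hcb : c ≤ b) (hlen : elapsedTime a c ≤ ℓ) (hℓ : 1 ≤ ℓ)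
    {μ K σ : ℝ} (hK : 0 ≤ K) (hK1 : 2 * ℓ * (γc * ψM ^ 2 + 1 / 2) ≤ K ^ 2)
    (hK2 : ℓ ^ 2 * (γc * ψM ^ 2 + 1 / 2) * (γc * ψM ^ 2 + 2) ≤ K ^ 2)
    (hμ : (excitation S ψ a c - μ • (1 : Matrix (Fin p) (Fin p) ℝ)).PosSemidef) (hσ0 : 0 ≤ σ)
    (hσ1 : σ < 1) (hσ : σ * (1 + K) ^ 2 ≤ 2 * (min γc (1 / (2 * (γd + ψM ^ 2))) * μ)) :
    ‖z c.1 c.2‖ ≤ √(1 - σ) * ‖z a.1 a.2‖ + 3 / √(1 - σ) * (ℓ * D) := by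
  have hD := h.nonneg
  have hγc := h.γc_pos
  have hℓ_pos : 0 < ℓ := by linarith
  have hB0 : 0 ≤ ‖z a.1 a.2‖ + D * ℓ := by positivity
  have hB : ∀ s k, (s, k) ∈ S → a ≤ (s, k) → (s, k) ≤ c → ‖z s k‖ ≤ ‖z a.1 a.2‖ + D * ℓ := by
    intro s k hs has hsc
    have : D * elapsedTime a (s, k) ≤ D * ℓ := by
      gcongr
      exact (elapsedTime_le_of_le hsc).trans hlen
    linarith [h.norm_le ha hs has (hsc.trans hcb)]
  have hexcursion := fun s k => h.norm_sub_le_of_elapsedTime_le ha hc hcb hB hB0 hℓ_pos hlen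
    (s := s) (k := k)
  have hexcited := h.sqrt_mul_norm_le_of_excitation ha hc hac hcb hB hB0 hlen (by positivity)
    hexcursion hμ
  have hY : 0 ≤ ‖z a.1 a.2‖ ^ 2 - ‖z c.1 c.2‖ ^ 2
      + (2 * D * (‖z a.1 a.2‖ + D * ℓ) + D ^ 2) * ℓ := by
    have hdecay := h.norm_sq_le ha hc hac hcb hB
    have : (2 * D * (‖z a.1 a.2‖ + D * ℓ) + D ^ 2) * elapsedTime a c
      ≤ (2 * D * (‖z a.1 a.2‖ + D * ℓ) + D ^ 2) * ℓ := by gcongr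
    linarith
  refine le_sqrt_mul_add_of_loss (norm_nonneg _) (by positivity) hσ0 hσ1 hY ?_
    (sqrt_mul_le_of_excited (norm_nonneg _) hY (by positivity) hσ0 hK hσ (by positivity) hK1 ?_
      hexcited)
  · have : ℓ * D ^ 2 ≤ ℓ ^ 2 * D ^ 2 := by
      gcongr
      nlinarith
    linarith
  · linarith

/-- Iterating the contraction backwards from `b` over consecutive windows of hybrid length between
`Δ` and `Δ + 1`. -/
theorem norm_le_exp_mul_add (h : IsPerturbedGradientArc S ψ γc γd ψM D b z) {Δ lam C₀ C : ℝ}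
    (hΔ : 0 < Δ) (hlam : 0 ≤ lam)
    (hwindow : ∀ a ∈ S, ∀ c ∈ S, a ≤ c → c ≤ b → IsWindow Δ a c →
      ‖z c.1 c.2‖ ≤ Real.exp (-lam * (Δ + 1)) * ‖z a.1 a.2‖ + C₀ * D)
    (hC₀ : C₀ ≤ (1 - Real.exp (-lam * (Δ + 1))) * C) (hC : Δ ≤ C) (hc : c ∈ S) (hcb : c ≤ b) :
    ‖z c.1 c.2‖ ≤ Real.exp (lam * (Δ + 1)) * Real.exp (-lam * (c.1 + c.2)) * ‖z 0 0‖ + C * D := by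
  have hD := h.nonneg
  obtain ⟨N, hN⟩ := exists_nat_gt ((c.1 + c.2) / Δ)
  rw [div_lt_iff₀ hΔ] at hN
  induction N generalizing c with
  | zero =>
    rw [Nat.cast_zero, zero_mul] at hN
    linarith [h.dom.fst_nonneg hc, c.2.cast_nonneg (α := ℝ)]
  | succ N ih =>
    rw [← Real.exp_add]
    rcases lt_or_ge (c.1 + c.2) Δ with hshort | hlong
    · calc ‖z c.1 c.2‖ ≤ 1 * ‖z 0 0‖ + D * (c.1 + c.2) := by
            simpa [elapsedTime] using h.norm_le h.dom.zero_mem hc (h.dom.zero_le_of_mem hc) hcb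
        _ ≤ Real.exp (lam * (Δ + 1) + -lam * (c.1 + c.2)) * ‖z 0 0‖ + D * C := by
            gcongr
            · rw [Real.one_le_exp_iff]
              nlinarith
            · linarith
        _ = _ := by ring
    · obtain ⟨a, ha, hac, hstart, hlt⟩ := h.dom.exists_le_sum_lt_add_one hc
        (c := c.1 + c.2 - Δ) (by linarith) (by linarith)
      have iha := ih ha (hac.trans hcb) (by push_cast at hN; linarith)
      set q := Real.exp (-lam * (Δ + 1))
      calc ‖z c.1 c.2‖ ≤ q * ‖z a.1 a.2‖ + C₀ * D :=
            hwindow a ha c hc hac hcb ⟨by linarith, by linarith⟩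
        _ ≤ q * (Real.exp (lam * (Δ + 1)) * Real.exp (-lam * (a.1 + a.2)) * ‖z 0 0‖ + C * D)
              + (1 - q) * C * D := by gcongr
        _ = Real.exp (-lam * (a.1 + a.2)) * ‖z 0 0‖ + C * D := by
            rw [mul_add, ← mul_assoc, ← mul_assoc, ← Real.exp_add, neg_mul, neg_add_cancel,
              Real.exp_zero]
            ring
        _ ≤ Real.exp (lam * (Δ + 1) + -lam * (c.1 + c.2)) * ‖z 0 0‖ + C * D := by
            gcongr
            nlinarith

end IsPerturbedGradientArc

/-! ### The distance to the target set -/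

theorem mulE_vecMulVec {n p : ℕ} (u : EuclideanSpace ℝ (Fin n)) (v w : EuclideanSpace ℝ (Fin p)) :
    mulE (Matrix.vecMulVec u v) w = inner ℝ v w • u := by
  ext i
  simp only [mulE, Matrix.mulVec, dotProduct, Matrix.vecMulVec_apply, PiLp.smul_apply, smul_eq_mul,
    PiLp.inner_apply, RCLike.inner_apply, conj_trivial, Finset.sum_mul]
  exact Finset.sum_congr rfl fun _ _ => by ring

theorem frobNorm_vecMulVec_sq {n p : ℕ} (u : EuclideanSpace ℝ (Fin n))
    (v : EuclideanSpace ℝ (Fin p)) :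
    frobNorm (Matrix.vecMulVec u v) ^ 2 = ‖u‖ ^ 2 * ‖v‖ ^ 2 := by
  simp only [frobNorm_sq, EuclideanSpace.real_norm_sq_eq, Matrix.vecMulVec_apply, mul_pow,
    Finset.sum_mul_sum]

theorem frobNorm_neg {n p : ℕ} (M : Matrix (Fin n) (Fin p) ℝ) : frobNorm (-M) = frobNorm M := by
  open scoped Matrix.Norms.Frobenius in exact norm_neg M

namespace EstState

variable {n p : ℕ}

section mk

variable (x eta : EuclideanSpace ℝ (Fin n)) (th : EuclideanSpace ℝ (Fin p))
  (psi : Matrix (Fin n) (Fin p) ℝ) (tau k : ℝ)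

@[simp] theorem x_mk : (mk x th psi eta tau k).x = x := rfl
@[simp] theorem th_mk : (mk x th psi eta tau k).th = th := rfl
@[simp] theorem psi_mk : (mk x th psi eta tau k).psi = psi := rfl
@[simp] theorem eta_mk : (mk x th psi eta tau k).eta = eta := rfl
@[simp] theorem tau_mk : (mk x th psi eta tau k).tau = tau := rfl
@[simp] theorem kReal_mk : (mk x th psi eta tau k).kReal = k := rfl
@[simp] theorem k_mk : (mk x th psi eta tau k).k = ⌊k⌋₊ := rfl

end mk

theorem norm_sq_eq (ξ : EstState n p) :
    ‖ξ‖ ^ 2 = ‖ξ.x‖ ^ 2 + ‖ξ.th‖ ^ 2 + frobNorm ξ.psi ^ 2 + ‖ξ.eta‖ ^ 2 + ξ.tau ^ 2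
      + ξ.kReal ^ 2 := by
  rw [frobNorm_sq, ← Fintype.sum_prod_type' (f := fun i j => ξ.psi i j ^ 2)]
  simp only [EuclideanSpace.norm_sq_eq, Fintype.sum_sum_type, Real.norm_eq_abs, sq_abs, x, th, psi,
    eta, tau, kReal, Matrix.of_apply, Finset.univ_unique, PUnit.default_eq_unit,
    Finset.sum_singleton]
  ring

@[simp] theorem x_sub (ξ ζ : EstState n p) : (ξ - ζ).x = ξ.x - ζ.x := rfl
@[simp] theorem th_sub (ξ ζ : EstState n p) : (ξ - ζ).th = ξ.th - ζ.th := rfl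
@[simp] theorem psi_sub (ξ ζ : EstState n p) : (ξ - ζ).psi = ξ.psi - ζ.psi := rfl
@[simp] theorem eta_sub (ξ ζ : EstState n p) : (ξ - ζ).eta = ξ.eta - ζ.eta := rfl
@[simp] theorem tau_sub (ξ ζ : EstState n p) : (ξ - ζ).tau = ξ.tau - ζ.tau := rfl
@[simp] theorem kReal_sub (ξ ζ : EstState n p) : (ξ - ζ).kReal = ξ.kReal - ζ.kReal := rfl

end EstState

namespace EstData

variable {n p m : ℕ} (W : EstData n p m) {ξ : EstState n p}

/-- The residual `ε` as a continuous linear map of the state. -/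
noncomputable def epsL : EstState n p →L[ℝ] EuclideanSpace ℝ (Fin n) :=
  LinearMap.toContinuousLinearMap
    { toFun := W.eps
      map_add' := fun ξ ζ => by
        change (ξ.x + ζ.x) + (ξ.eta + ζ.eta) - mulE (ξ.psi + ζ.psi) W.theta = _
        rw [add_mulE, eps, eps]
        abel
      map_smul' := fun c ξ => by
        change c • ξ.x + c • ξ.eta - mulE (c • ξ.psi) W.theta = c • W.eps ξ
        rw [smul_mulE, eps, smul_sub, smul_add] }

theorem eps_sub (ξ ζ : EstState n p) : W.eps (ξ - ζ) = W.eps ξ - W.eps ζ :=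
  map_sub W.epsL ξ ζ

theorem norm_eps_sq_le (ξ : EstState n p) :
    ‖W.eps ξ‖ ^ 2 ≤ (2 + ‖W.theta‖ ^ 2) * (‖ξ.x‖ ^ 2 + ‖ξ.eta‖ ^ 2 + frobNorm ξ.psi ^ 2) := by
  have htriangle : ‖W.eps ξ‖ ≤ ‖ξ.x‖ + ‖ξ.eta‖ + frobNorm ξ.psi * ‖W.theta‖ :=
    (norm_sub_le _ _).trans (add_le_add (norm_add_le _ _) (norm_mulE_le_frobNorm _ _))
  refine (pow_le_pow_left₀ (norm_nonneg _) htriangle 2).trans ?_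
  nlinarith [sq_nonneg (‖ξ.x‖ - ‖ξ.eta‖), sq_nonneg (‖ξ.x‖ * ‖W.theta‖ - frobNorm ξ.psi),
    sq_nonneg (‖ξ.eta‖ * ‖W.theta‖ - frobNorm ξ.psi)]

/-- The share of the residual `ε` that the nearest point of the target set takes off `x` and `η`;
the weights make the correction of `(x, ψ, η)` orthogonal to the kernel of `ε`. -/
noncomputable def residualShare (ξ : EstState n p) : EuclideanSpace ℝ (Fin n) :=
  (1 / (2 + ‖W.theta‖ ^ 2)) • W.eps ξ

theorem two_add_sq_smul_residualShare (ξ : EstState n p) :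
    (2 + ‖W.theta‖ ^ 2) • W.residualShare ξ = W.eps ξ := by
  rw [residualShare, smul_smul, mul_one_div_cancel (by positivity), one_smul]

/-- The point of the target set nearest to `ξ`. -/
noncomputable def targetProj (ξ : EstState n p) : EstState n p :=
  EstState.mk (ξ.x - W.residualShare ξ) W.theta
    (ξ.psi + Matrix.vecMulVec (W.residualShare ξ) W.theta) (ξ.eta - W.residualShare ξ) ξ.tau ξ.kReal

theorem targetProj_mem_target (hξ : ξ ∈ W.stateSet) : W.targetProj ξ ∈ W.target := by
  refine ⟨hξ, rfl, ?_⟩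
  calc W.eps (W.targetProj ξ) = W.eps ξ - (2 + ‖W.theta‖ ^ 2) • W.residualShare ξ := by
        simp only [eps, targetProj, EstState.x_mk, EstState.eta_mk, EstState.psi_mk, add_mulE,
          mulE_vecMulVec, real_inner_self_eq_norm_sq]
        module
    _ = 0 := by rw [two_add_sq_smul_residualShare, sub_self]

theorem norm_sub_targetProj_sq (ξ : EstState n p) :
    ‖ξ - W.targetProj ξ‖ ^ 2
      = ‖W.theta - ξ.th‖ ^ 2 + ‖W.eps ξ‖ ^ 2 / (2 + ‖W.theta‖ ^ 2) := by
  have hshare : ‖W.eps ξ‖ ^ 2 / (2 + ‖W.theta‖ ^ 2)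
      = (2 + ‖W.theta‖ ^ 2) * ‖W.residualShare ξ‖ ^ 2 := by
    have : (2 + ‖W.theta‖ ^ 2) ≠ 0 := by positivity
    rw [residualShare, norm_smul, Real.norm_of_nonneg (by positivity)]
    field_simp
  rw [EstState.norm_sq_eq, hshare, norm_sub_rev W.theta]
  simp only [targetProj, EstState.x_sub, EstState.th_sub, EstState.psi_sub, EstState.eta_sub,
    EstState.tau_sub, EstState.kReal_sub, EstState.x_mk, EstState.th_mk, EstState.psi_mk,
    EstState.eta_mk, EstState.tau_mk, EstState.kReal_mk, sub_self, sub_sub_cancel,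
    sub_add_cancel_left, frobNorm_neg, frobNorm_vecMulVec_sq]
  ring

theorem le_norm_sub_sq_of_mem_target (ξ : EstState n p) {ζ : EstState n p} (hζ : ζ ∈ W.target) :
    ‖W.theta - ξ.th‖ ^ 2 + ‖W.eps ξ‖ ^ 2 / (2 + ‖W.theta‖ ^ 2) ≤ ‖ξ - ζ‖ ^ 2 := by
  obtain ⟨-, hth, heps⟩ := hζ
  have hε := W.norm_eps_sq_le (ξ - ζ)
  rw [eps_sub, heps, sub_zero, ← div_le_iff₀' (by positivity)] at hε
  rw [EstState.norm_sq_eq, EstState.th_sub, hth, norm_sub_rev ξ.th]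
  nlinarith [sq_nonneg (ξ - ζ).tau, sq_nonneg (ξ - ζ).kReal]

theorem infDist_target (hξ : ξ ∈ W.stateSet) :
    Metric.infDist ξ W.target
      = √(‖W.theta - ξ.th‖ ^ 2 + ‖W.eps ξ‖ ^ 2 / (2 + ‖W.theta‖ ^ 2)) := by
  have hproj := W.targetProj_mem_target hξ
  refine le_antisymm ?_ ((Metric.le_infDist ⟨_, hproj⟩).2 fun ζ hζ => ?_)
  · rw [← norm_sub_targetProj_sq, Real.sqrt_sq (norm_nonneg _), ← dist_eq_norm]
    exact Metric.infDist_le_dist_of_mem hproj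
  · rw [dist_eq_norm]
    exact Real.sqrt_le_iff.2 ⟨norm_nonneg _, W.le_norm_sub_sq_of_mem_target ξ hζ⟩

end EstData

/-! ### The constants -/

theorem neg_log_one_sub_pos {x : ℝ} (hx : x ∈ Ioo (0 : ℝ) 1) : 0 < -Real.log (1 - x) :=
  neg_pos.2 (Real.log_neg (by linarith [hx.2]) (by linarith [hx.1]))

theorem one_le_exp_div_exp_sub_one {x : ℝ} (hx : 0 < x) : 1 ≤ Real.exp x / (Real.exp x - 1) := by
  rw [le_div_iff₀ (by linarith [Real.add_one_lt_exp hx.ne'])]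
  linarith

theorem one_div_le_exp_div_exp_sub_one {x : ℝ} (hx : 0 < x) :
    1 / x ≤ Real.exp x / (Real.exp x - 1) := by
  have hinv : Real.exp (-x) * Real.exp x = 1 := by
    rw [← Real.exp_add, neg_add_cancel, Real.exp_zero]
  rw [div_le_div_iff₀ hx (by linarith [Real.add_one_lt_exp hx.ne'])]
  nlinarith [Real.add_one_le_exp (-x), Real.exp_pos x]

theorem le_one_sub_exp_neg_mul_exp (x : ℝ) : x ≤ (1 - Real.exp (-x)) * Real.exp x := by
  rw [sub_mul, one_mul, ← Real.exp_add, neg_add_cancel, Real.exp_zero]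
  linarith [Real.add_one_le_exp x]

theorem div_two_le_one_sub_abs_one_sub {l : ℝ} (hl : l ∈ Ioo (0 : ℝ) 2) :
    l * (2 - l) / 2 ≤ 1 - |1 - l| := by
  have : |1 - l| ≤ 1 := abs_le.2 ⟨by linarith [hl.2], by linarith [hl.1]⟩
  nlinarith [sq_abs (1 - l), abs_nonneg (1 - l)]

namespace EstParams

variable {P : EstParams}

/-- The square root in the definition of `σ`. -/
noncomputable def rootK (P : EstParams) : ℝ :=
  √((P.aM + 2) * (P.Delta + 2) ^ 3 * (P.aM * (P.Delta + 2) + 1 / 2))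

theorem sigma_eq : P.sigma = 2 * P.mu0 / (1 + P.rootK) ^ 2 := rfl

theorem rootK_nonneg : 0 ≤ P.rootK := Real.sqrt_nonneg _

theorem sigma_mul_sq : P.sigma * (1 + P.rootK) ^ 2 = 2 * P.mu0 := by
  have := P.rootK_nonneg
  rw [sigma_eq, div_mul_cancel₀ _ (by positivity)]

/-- The gain `R` for which `R * φ_M` bounds the response of `ψ` to the regressors. -/
noncomputable def psiGain (P : EstParams) : ℝ :=
  max (1 / P.lamc) (√(2 * P.lamd * (2 - P.lamd) + 16) / (P.lamd * (2 - P.lamd)))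

namespace Admissible

theorem psiM_pos (hP : P.Admissible) : 0 < P.psiM := by
  have := hP.psi0_nonneg
  have := hP.phiM_pos
  have := hP.lamc_pos
  unfold psiM
  positivity

theorem aM_pos (hP : P.Admissible) : 0 < P.aM :=
  mul_pos hP.gamc_pos (pow_pos hP.psiM_pos 2)

theorem mu0_pos (hP : P.Admissible) : 0 < P.mu0 := by
  have := hP.gamc_pos
  have := hP.gamd_pos
  have := hP.mu_pos
  unfold mu0
  positivity

theorem sigma_pos (hP : P.Admissible) : 0 < P.sigma := by
  have := hP.mu0_pos
  have := P.rootK_nonneg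
  rw [sigma_eq]
  positivity

theorem rootK_sq (hP : P.Admissible) :
    P.rootK ^ 2 = (P.aM + 2) * (P.Delta + 2) ^ 3 * (P.aM * (P.Delta + 2) + 1 / 2) := by
  have := hP.aM_pos
  have := hP.Delta_pos
  exact Real.sq_sqrt (by positivity)

theorem aM_add_half_le (hP : P.Admissible) : P.aM + 1 / 2 ≤ P.aM * (P.Delta + 2) + 1 / 2 := by
  nlinarith [hP.aM_pos, hP.Delta_pos]

theorem two_mul_window_mul_le_rootK_sq (hP : P.Admissible) :
    2 * (P.Delta + 1) * (P.aM + 1 / 2) ≤ P.rootK ^ 2 := by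
  have ha := hP.aM_pos
  have hΔ := hP.Delta_pos
  have hwindow : P.Delta + 1 ≤ (P.Delta + 2) ^ 3 := by
    linarith [le_self_pow₀ (by linarith : 1 ≤ P.Delta + 2) three_ne_zero]
  have hhalf := hP.aM_add_half_le
  rw [hP.rootK_sq]
  gcongr
  linarith

theorem window_sq_mul_le_rootK_sq (hP : P.Admissible) :
    (P.Delta + 1) ^ 2 * (P.aM + 1 / 2) * (P.aM + 2) ≤ P.rootK ^ 2 := by
  have ha := hP.aM_pos
  have hΔ := hP.Delta_pos
  have hwindow : (P.Delta + 1) ^ 2 ≤ (P.Delta + 2) ^ 3 :=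
    calc (P.Delta + 1) ^ 2 ≤ (P.Delta + 2) ^ 2 := by gcongr; norm_num
      _ ≤ (P.Delta + 2) ^ 3 := pow_le_pow_right₀ (by linarith) (by norm_num)
  have hhalf := hP.aM_add_half_le
  rw [hP.rootK_sq, mul_comm _ (P.aM + 2), ← mul_assoc]
  gcongr

theorem sigma_lt_one_of_mu_le (hP : P.Admissible) (h : P.mu ≤ P.psiM ^ 2 * (P.Delta + 1)) :
    P.sigma < 1 := by
  have hK := P.rootK_nonneg
  have hμ : P.mu0 ≤ P.aM * (P.Delta + 1) :=
    calc P.mu0 ≤ P.gamc * P.mu := mul_le_mul_of_nonneg_right (min_le_left _ _) hP.mu_pos.le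
      _ ≤ P.gamc * (P.psiM ^ 2 * (P.Delta + 1)) := mul_le_mul_of_nonneg_left h hP.gamc_pos.le
      _ = P.aM * (P.Delta + 1) := by rw [aM, mul_assoc]
  rw [sigma_eq, div_lt_one (by positivity)]
  nlinarith [hP.two_mul_window_mul_le_rootK_sq, hP.Delta_pos]

theorem lam0_pos (hP : P.Admissible) (hσ : P.sigma < 1) : 0 < P.lam0 :=
  div_pos (neg_log_one_sub_pos ⟨hP.sigma_pos, hσ⟩) (by linarith [hP.Delta_pos])

theorem sqrt_one_sub_sigma (hP : P.Admissible) (hσ : P.sigma < 1) :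
    √(1 - P.sigma) = Real.exp (-P.lam0 * (P.Delta + 1)) := by
  have := hP.Delta_pos
  have hexponent : -P.lam0 * (P.Delta + 1) = Real.log (1 - P.sigma) / 2 := by
    rw [lam0]
    field_simp
  rw [hexponent, Real.exp_half, Real.exp_log (by linarith)]

theorem kappa0_eq_exp (hP : P.Admissible) (hσ : P.sigma < 1) :
    P.kappa0 = Real.exp (P.lam0 * (P.Delta + 1)) := by
  rw [kappa0, one_div, Real.sqrt_inv, hP.sqrt_one_sub_sigma hσ, ← Real.exp_neg, neg_mul, neg_neg]

theorem one_le_kappa0 (hP : P.Admissible) (hσ : P.sigma < 1) : 1 ≤ P.kappa0 := by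
  have := hP.lam0_pos hσ
  have := hP.Delta_pos
  rw [hP.kappa0_eq_exp hσ, Real.one_le_exp_iff]
  positivity

theorem add_add_mul_kappa0_sq_le_pM (hP : P.Admissible) (hσ : P.sigma < 1) {r : ℝ}
    (hr0 : 0 ≤ r) (hr : r ≤ Real.exp (2 * P.lam0) / (Real.exp (2 * P.lam0) - 1)) :
    P.qm + P.qm * P.kappa0 ^ 2 / (2 * P.lam0) + P.qm * P.kappa0 ^ 2 * r ≤ P.pM := by
  have hlam := hP.lam0_pos hσ
  have hqm := hP.qm_pos
  have hqM := hP.qm_le_qM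
  have : 0 ≤ P.qM := hqm.le.trans hqM
  rw [pM, mul_div_assoc (P.qM * P.kappa0 ^ 2)]
  gcongr

theorem mul_kappa0_sq_le_pM (hP : P.Admissible) (hσ : P.sigma < 1) :
    P.qm * P.kappa0 ^ 2 ≤ P.pM := by
  have hlam := hP.lam0_pos hσ
  have hqm := hP.qm_pos
  have : 0 ≤ P.qm * P.kappa0 ^ 2 / (2 * P.lam0) := by positivity
  linarith [hP.add_add_mul_kappa0_sq_le_pM hσ zero_le_one
    (one_le_exp_div_exp_sub_one (by positivity))]

theorem kappa0_sq_div_lam0_le (hP : P.Admissible) (hσ : P.sigma < 1) :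
    P.kappa0 ^ 2 / P.lam0 ≤ P.pM / P.qm := by
  have hlam := hP.lam0_pos hσ
  have hqm := hP.qm_pos
  have hsplit : P.kappa0 ^ 2 / P.lam0 * P.qm = P.qm * P.kappa0 ^ 2 / (2 * P.lam0)
      + P.qm * P.kappa0 ^ 2 * (1 / (2 * P.lam0)) := by
    field_simp
    ring
  rw [le_div_iff₀ hqm, hsplit]
  linarith [hP.add_add_mul_kappa0_sq_le_pM hσ (by positivity)
    (one_div_le_exp_div_exp_sub_one (by positivity))]

theorem qm_le_pM (hP : P.Admissible) (hσ : P.sigma < 1) : P.qm ≤ P.pM :=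
  (le_mul_of_one_le_right hP.qm_pos.le (one_le_pow₀ (hP.one_le_kappa0 hσ))).trans
    (hP.mul_kappa0_sq_le_pM hσ)

theorem pM_pos (hP : P.Admissible) (hσ : P.sigma < 1) : 0 < P.pM :=
  hP.qm_pos.trans_le (hP.qm_le_pM hσ)

theorem kappa0_le_kappaNu (hP : P.Admissible) (hσ : P.sigma < 1) : P.kappa0 ≤ P.kappaNu := by
  refine Real.le_sqrt_of_sq_le ?_
  rw [pm, le_div_iff₀ hP.qm_pos]
  linarith [hP.mul_kappa0_sq_le_pM hσ, hP.pM_pos hσ]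

theorem one_le_kappaNu (hP : P.Admissible) (hσ : P.sigma < 1) : 1 ≤ P.kappaNu :=
  (hP.one_le_kappa0 hσ).trans (hP.kappa0_le_kappaNu hσ)

theorem kappaNu_pos (hP : P.Admissible) (hσ : P.sigma < 1) : 0 < P.kappaNu :=
  zero_lt_one.trans_le (hP.one_le_kappaNu hσ)

theorem qm_div_two_mul_pM_mem (hP : P.Admissible) (hσ : P.sigma < 1) :
    P.qm / (2 * P.pM) ∈ Ioo (0 : ℝ) 1 := by
  have hqm := hP.qm_pos
  have hpM := hP.pM_pos hσ
  refine ⟨by positivity, ?_⟩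
  rw [div_lt_one (by positivity)]
  linarith [hP.qm_le_pM hσ]

theorem omega_pos (hP : P.Admissible) (hσ : P.sigma < 1) : 0 < P.omega := by
  obtain ⟨hq0, hq1⟩ := hP.qm_div_two_mul_pM_mem hσ
  obtain ⟨hz0, hz1⟩ := hP.zeta_mem
  have hrate : P.qm / (2 * P.pM) * (1 - P.zeta) ∈ Ioo (0 : ℝ) 1 :=
    ⟨mul_pos hq0 (by linarith), by nlinarith⟩
  exact mul_pos (by norm_num) (lt_min hrate.1 (neg_log_one_sub_pos hrate))

theorem omega_le_lam0 (hP : P.Admissible) (hσ : P.sigma < 1) : P.omega ≤ P.lam0 := by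
  have hlam := hP.lam0_pos hσ
  have hqm := hP.qm_pos
  have hpM := hP.pM_pos hσ
  have hκ : 1 ≤ P.kappa0 ^ 2 := one_le_pow₀ (hP.one_le_kappa0 hσ)
  have hinv : 1 / P.lam0 ≤ P.pM / P.qm :=
    (div_le_div_of_nonneg_right hκ hlam.le).trans (hP.kappa0_sq_div_lam0_le hσ)
  rw [div_le_div_iff₀ hlam hqm] at hinv
  have hrate : P.qm / (2 * P.pM) ≤ P.lam0 := by
    rw [div_le_iff₀ (by positivity)]
    nlinarith
  have homega : P.omega ≤ 1 / 2 * (P.qm / (2 * P.pM) * (1 - P.zeta)) :=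
    mul_le_mul_of_nonneg_left (min_le_left _ _) (by norm_num)
  nlinarith [hP.zeta_mem.1, hP.zeta_mem.2, (hP.qm_div_two_mul_pM_mem hσ).1]

theorem three_mul_le_sqrt_two_mul_rho (hP : P.Admissible) (hσ : P.sigma < 1) :
    3 * (P.pM / P.qm) ≤ √2 * P.rho := by
  have hqm := hP.qm_pos
  have hpM := hP.pM_pos hσ
  obtain ⟨hz0, hz1⟩ := hP.zeta_mem
  have hratio : 1 ≤ P.pM / P.qm := (one_le_div hqm).2 (hP.qm_le_pM hσ)
  have hrho : 2 * (2 * P.pM ^ 2 / (P.qm * P.pm * P.zeta) * (2 * P.pM / P.qm + 1))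
      = 4 * (P.pM / P.qm) ^ 2 * (2 * (P.pM / P.qm) + 1) / P.zeta := by
    rw [pm]
    field_simp
    ring
  rw [rho, ← Real.sqrt_mul zero_le_two, hrho]
  refine Real.le_sqrt_of_sq_le ?_
  set x := P.pM / P.qm
  calc (3 * x) ^ 2 ≤ 4 * x ^ 2 * (2 * x + 1) := by nlinarith [sq_nonneg x]
    _ ≤ 4 * x ^ 2 * (2 * x + 1) / P.zeta := le_div_self (by positivity) hz0 hz1.le

theorem rho_pos (hP : P.Admissible) (hσ : P.sigma < 1) : 0 < P.rho := by
  have hqm := hP.qm_pos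
  have hpM := hP.pM_pos hσ
  have hz := hP.zeta_mem.1
  unfold rho pm
  positivity

theorem three_mul_kappa0_mul_le (hP : P.Admissible) (hσ : P.sigma < 1) :
    3 * P.kappa0 * (P.Delta + 1) ≤ (1 - Real.exp (-P.lam0 * (P.Delta + 1))) * (√2 * P.rho) := by
  have hlam := hP.lam0_pos hσ
  have hΔ := hP.Delta_pos
  have hκ := hP.one_le_kappa0 hσ
  have hgap := le_one_sub_exp_neg_mul_exp (P.lam0 * (P.Delta + 1))
  rw [← neg_mul, ← hP.kappa0_eq_exp hσ] at hgap
  have hgap_nonneg : 0 ≤ 1 - Real.exp (-P.lam0 * (P.Delta + 1)) := by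
    rw [sub_nonneg, Real.exp_le_one_iff]
    nlinarith
  set g := 1 - Real.exp (-P.lam0 * (P.Delta + 1))
  calc 3 * P.kappa0 * (P.Delta + 1)
      = P.lam0 * (P.Delta + 1) * (3 * (P.kappa0 / P.lam0)) := by field_simp
    _ ≤ g * P.kappa0 * (3 * (P.kappa0 / P.lam0)) := by gcongr
    _ = g * (3 * (P.kappa0 ^ 2 / P.lam0)) := by ring
    _ ≤ g * (√2 * P.rho) := mul_le_mul_of_nonneg_left
        (by linarith [hP.kappa0_sq_div_lam0_le hσ, hP.three_mul_le_sqrt_two_mul_rho hσ])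
        hgap_nonneg

theorem Delta_le_sqrt_two_mul_rho (hP : P.Admissible) (hσ : P.sigma < 1) :
    P.Delta ≤ √2 * P.rho := by
  have hΔ := hP.Delta_pos
  have hκ := hP.one_le_kappa0 hσ
  have hρ := hP.rho_pos hσ
  have hgap := hP.three_mul_kappa0_mul_le hσ
  have : 0 < Real.exp (-P.lam0 * (P.Delta + 1)) * (√2 * P.rho) := by positivity
  nlinarith

theorem lamd_mul_mem (hP : P.Admissible) : P.lamd * (2 - P.lamd) ∈ Ioc (0 : ℝ) 1 :=
  ⟨mul_pos hP.lamd_mem.1 (by linarith [hP.lamd_mem.2]), by nlinarith [sq_nonneg (1 - P.lamd)]⟩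

theorem lamd_rate_mem (hP : P.Admissible) :
    P.lamd / 2 * (2 - P.lamd) * (1 - P.zeta) ∈ Ioo (0 : ℝ) 1 := by
  obtain ⟨hd0, hd1⟩ := hP.lamd_mul_mem
  obtain ⟨hz0, hz1⟩ := hP.zeta_mem
  have : 0 < P.lamd * (2 - P.lamd) * (1 - P.zeta) := mul_pos hd0 (by linarith)
  exact ⟨by linarith, by nlinarith⟩

theorem lamEps_pos (hP : P.Admissible) : 0 < P.lamEps :=
  mul_pos (by norm_num) (lt_min (mul_pos hP.lamc_pos (by linarith [hP.zeta_mem.2]))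
    (neg_log_one_sub_pos hP.lamd_rate_mem))

theorem lamEps_le_lamc (hP : P.Admissible) : P.lamEps ≤ P.lamc := by
  have hlamEps : P.lamEps ≤ 1 / 2 * (P.lamc * (1 - P.zeta)) :=
    mul_le_mul_of_nonneg_left (min_le_left _ _) (by norm_num)
  nlinarith [hP.lamc_pos, hP.zeta_mem.1, hP.zeta_mem.2]

theorem abs_one_sub_lamd_le_exp (hP : P.Admissible) : |1 - P.lamd| ≤ Real.exp (-P.lamEps) := by
  have hrate := hP.lamd_rate_mem
  have hlamEps : P.lamEps ≤ 1 / 2 * -Real.log (1 - P.lamd / 2 * (2 - P.lamd) * (1 - P.zeta)) :=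
    mul_le_mul_of_nonneg_left (min_le_right _ _) (by norm_num)
  calc |1 - P.lamd| ≤ √(1 - P.lamd / 2 * (2 - P.lamd) * (1 - P.zeta)) := by
        refine Real.abs_le_sqrt ?_
        nlinarith [hP.lamd_mul_mem.1, hP.zeta_mem.1]
    _ = Real.exp (Real.log (1 - P.lamd / 2 * (2 - P.lamd) * (1 - P.zeta)) / 2) := by
        rw [Real.exp_half, Real.exp_log (by linarith [hrate.2])]
    _ ≤ Real.exp (-P.lamEps) := Real.exp_le_exp.2 (by linarith)

theorem one_le_lamc_mul_psiGain (hP : P.Admissible) : 1 ≤ P.lamc * P.psiGain :=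
  (div_le_iff₀' hP.lamc_pos).1 (le_max_left _ _)

theorem one_le_gap_mul_psiGain (hP : P.Admissible) : 1 ≤ (1 - |1 - P.lamd|) * P.psiGain := by
  have hd := hP.lamd_mul_mem.1
  have hfour : 4 / (P.lamd * (2 - P.lamd)) ≤ P.psiGain := by
    refine le_trans ?_ (le_max_right _ _)
    gcongr
    exact Real.le_sqrt_of_sq_le (by nlinarith)
  rw [div_le_iff₀ hd] at hfour
  have hgap := div_two_le_one_sub_abs_one_sub hP.lamd_mem
  have : 0 < P.psiGain := lt_max_of_lt_left (one_div_pos.2 hP.lamc_pos)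
  nlinarith

theorem psiGain_le_rhoEps (hP : P.Admissible) : P.psiGain ≤ P.rhoEps := by
  have hc := hP.lamc_pos
  have hd := hP.lamd_mul_mem.1
  have hz := Real.sqrt_pos.2 hP.zeta_mem.1
  have hz1 : √P.zeta ≤ 1 := Real.sqrt_le_one.2 hP.zeta_mem.2.le
  refine max_le_max ?_ ?_
  · gcongr
    · norm_num
    · exact mul_le_of_le_one_right hc.le hz1
  · exact div_le_div_of_nonneg_left (Real.sqrt_nonneg _) (by positivity)
      (mul_le_of_le_one_right hd.le hz1)

theorem rhoEps_pos (hP : P.Admissible) : 0 < P.rhoEps :=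
  (lt_max_of_lt_left (one_div_pos.2 hP.lamc_pos)).trans_le hP.psiGain_le_rhoEps

theorem one_le_lamc_mul_rhoEps (hP : P.Admissible) : 1 ≤ P.lamc * P.rhoEps :=
  hP.one_le_lamc_mul_psiGain.trans
    (mul_le_mul_of_nonneg_left hP.psiGain_le_rhoEps hP.lamc_pos.le)

theorem one_le_gap_mul_rhoEps (hP : P.Admissible) : 1 ≤ (1 - |1 - P.lamd|) * P.rhoEps :=
  hP.one_le_gap_mul_psiGain.trans (mul_le_mul_of_nonneg_left hP.psiGain_le_rhoEps
    (by linarith [div_two_le_one_sub_abs_one_sub hP.lamd_mem, hP.lamd_mul_mem.1]))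

theorem lamNu_pos (hP : P.Admissible) (hσ : P.sigma < 1) : 0 < P.lamNu :=
  lt_min (hP.omega_pos hσ) hP.lamEps_pos

theorem lamNu_le_lam0 (hP : P.Admissible) (hσ : P.sigma < 1) : P.lamNu ≤ P.lam0 :=
  (min_le_left _ _).trans (hP.omega_le_lam0 hσ)

theorem rhoNu_pos (hP : P.Admissible) : 0 < P.rhoNu :=
  mul_pos (by positivity) (hP.rhoEps_pos.trans_le (le_max_right _ _))

theorem rhoEps_le_rhoNu (hP : P.Admissible) : P.rhoEps ≤ P.rhoNu :=
  calc P.rhoEps ≤ √2 * P.rhoEps :=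
        le_mul_of_one_le_left hP.rhoEps_pos.le (Real.one_le_sqrt.2 one_le_two)
    _ ≤ P.rhoNu := by
        unfold rhoNu
        gcongr
        exact le_max_right _ _

end Admissible

theorem lamNu_le_lamEps : P.lamNu ≤ P.lamEps := min_le_right _ _

theorem sqrt_two_mul_rho_le_rhoNu : √2 * P.rho ≤ P.rhoNu := by
  unfold rhoNu
  gcongr
  exact le_max_left _ _

end EstParams

/-! ### The estimation errors along a solution -/

namespace EstState

variable {n p : ℕ}

/-- The parameter estimate `θ̂` as a continuous linear map of the state. -/
noncomputable def thL : EstState n p →L[ℝ] EuclideanSpace ℝ (Fin p) :=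
  LinearMap.toContinuousLinearMap
    { toFun := th, map_add' := fun _ _ => rfl, map_smul' := fun _ _ => rfl }

/-- The entries of `ψ` as a continuous linear map of the state, with values in a Euclidean space so
that its norm is the Frobenius norm. -/
noncomputable def psiL : EstState n p →L[ℝ] EuclideanSpace ℝ (Fin n × Fin p) :=
  LinearMap.toContinuousLinearMap
    { toFun := fun ξ => WithLp.toLp 2 fun q => ξ.psi q.1 q.2
      map_add' := fun _ _ => rfl
      map_smul' := fun _ _ => rfl }

theorem norm_psiL (ξ : EstState n p) : ‖psiL ξ‖ = frobNorm ξ.psi :=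
  (frobNorm_eq_norm ξ.psi).symm

end EstState

namespace EstData

variable {n p m : ℕ} {W : EstData n p m} {P : EstParams} {S : Set (ℝ × ℕ)}
  {ξ : ℝ → ℕ → EstState n p}

theorem eps_flowMap (t : ℝ) (j : ℕ) :
    W.eps (W.flowMap P (ξ t j)) = -P.lamc • W.eps (ξ t j) + W.alphac P ξ t j := by
  simp only [eps, flowMap, alphac, nuAt, uAt, EstState.x_mk, EstState.eta_mk, EstState.psi_mk,
    add_mulE, smul_mulE]
  module

theorem eps_jumpMap (t : ℝ) (j : ℕ) :
    W.eps (W.jumpMap P (ξ t j)) = (1 - P.lamd) • W.eps (ξ t j) + W.alphad P ξ t j := by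
  simp only [eps, jumpMap, alphad, nuAt, uAt, EstState.x_mk, EstState.eta_mk, EstState.psi_mk,
    add_mulE, smul_mulE]
  module

theorem psiL_flowMap (ζ : EstState n p) :
    EstState.psiL (W.flowMap P ζ) = -P.lamc • EstState.psiL ζ
      + WithLp.toLp 2 fun q => W.phic ζ.tau ζ.k q.1 q.2 := rfl

theorem psiL_jumpMap (ζ : EstState n p) :
    EstState.psiL (W.jumpMap P ζ) = (1 - P.lamd) • EstState.psiL ζ
      + WithLp.toLp 2 fun q => W.phid ζ.tau ζ.k q.1 q.2 := rfl

theorem output_sub_mulE (ζ : EstState n p) (v : EuclideanSpace ℝ (Fin n))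
    (th : EuclideanSpace ℝ (Fin p)) :
    ζ.x + v + ζ.eta - mulE ζ.psi th = mulE ζ.psi (W.theta - th) + (W.eps ζ + v) := by
  rw [eps, mulE_sub]
  abel

theorem neg_th_flowMap (t : ℝ) (j : ℕ) :
    -(W.flowMap P (ξ t j)).th
      = gradientFlow P.gamc (ξ t j).psi (W.theta - (ξ t j).th) + W.dc P ξ t j := by
  rw [flowMap, EstState.th_mk, W.output_sub_mulE, mulE_add, smul_add, neg_add, gradientFlow, dc,
    nuAt]

theorem norm_alphac_le {Lc : ℝ} (hlamc : 0 ≤ P.lamc)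
    (hfc : ∀ x₁ x₂ u, ‖W.fc x₁ u - W.fc x₂ u‖ ≤ Lc * ‖x₁ - x₂‖) (t : ℝ) (j : ℕ) :
    ‖W.alphac P ξ t j‖ ≤ (P.lamc + Lc) * ‖W.nuAt ξ t j‖ := by
  have hlip := hfc (ξ t j).x ((ξ t j).x + W.nuAt ξ t j) (W.uAt ξ t j)
  rw [sub_add_cancel_left, norm_neg] at hlip
  rw [alphac, add_sub_assoc, add_mul]
  refine (norm_add_le _ _).trans (add_le_add ?_ hlip)
  rw [norm_smul, norm_neg, Real.norm_of_nonneg hlamc]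

theorem norm_alphad_le {Ld : ℝ}
    (hgd : ∀ x₁ x₂ u, ‖W.gd x₁ u - W.gd x₂ u‖ ≤ Ld * ‖x₁ - x₂‖) (t : ℝ) (j : ℕ) :
    ‖W.alphad P ξ t j‖ ≤ (|1 - P.lamd| + Ld) * ‖W.nuAt ξ t j‖ := by
  have hlip := hgd (ξ t j).x ((ξ t j).x + W.nuAt ξ t j) (W.uAt ξ t j)
  rw [sub_add_cancel_left, norm_neg] at hlip
  rw [alphad, add_sub_assoc, add_mul]
  refine (norm_add_le _ _).trans (add_le_add ?_ hlip)
  rw [norm_smul, Real.norm_eq_abs]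

section Solution

variable (hξ : (W.noisySystem P).IsSolution S ξ)
include hξ

theorem isHybridArc_clm {V : Type*} [NormedAddCommGroup V] [NormedSpace ℝ V]
    (L : EstState n p →L[ℝ] V) : IsHybridArc S fun s k => L (ξ s k) :=
  IsHybridArc.comp_lipschitz hξ.abs_cont L.lipschitz

theorem ae_hasDerivAt_clm {V : Type*} [NormedAddCommGroup V] [NormedSpace ℝ V]
    (L : EstState n p →L[ℝ] V) (k : ℕ) :
    ∀ᵐ s, s ∈ interior (timeSlice S k) →
      HasDerivAt (fun r => L (ξ r k)) (L (W.flowMap P (ξ s k))) s := by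
  filter_upwards [hξ.flow k] with s hs hmem
  exact L.hasFDerivAt.comp_hasDerivAt s (hs hmem)

theorem nuAt_succ {t : ℝ} {j : ℕ} (h : (t, j) ∈ jumpPoints S) :
    W.nuAt ξ t (j + 1) = W.nu (ξ t j).tau ((ξ t j).k + 1) := by
  have hcounter : (ξ t j).kReal + 1 = ((ξ t j).k + 1 : ℕ) := by
    rw [(hξ.mem_state t j h.1).1, Nat.cast_succ]
  have hjump : ξ t (j + 1) = W.jumpMap P (ξ t j) := hξ.jump t j h
  rw [nuAt, hjump, jumpMap, EstState.tau_mk, EstState.k_mk, hcounter, Nat.floor_natCast]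

theorem theta_sub_th_succ {t : ℝ} {j : ℕ} (h : (t, j) ∈ jumpPoints S) :
    W.theta - (ξ t (j + 1)).th
      = gradientStep P.gamd (ξ t (j + 1)).psi (W.theta - (ξ t j).th) + W.dd P ξ t j := by
  have hth : (ξ t (j + 1)).th = (ξ t j).th + stepSize P.gamd (ξ t (j + 1)).psi •
      mulE (ξ t (j + 1)).psiᵀ ((ξ t (j + 1)).x + W.nuAt ξ t (j + 1) + (ξ t (j + 1)).eta
        - mulE (ξ t (j + 1)).psi (ξ t j).th) := by
    rw [nuAt_succ hξ h, hξ.jump t j h]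
    rfl
  rw [hth, W.output_sub_mulE, mulE_add, smul_add, gradientStep, dd, ← stepSize]
  abel

theorem frobNorm_psi_le (hP : P.Admissible)
    (hphic : ∀ t j, (t, j) ∈ W.E → frobNorm (W.phic t j) ≤ P.phiM)
    (hphid : ∀ t j, (t, j) ∈ jumpPoints W.E → frobNorm (W.phid t j) ≤ P.phiM)
    (hψ0 : frobNorm (ξ 0 0).psi ≤ P.psi0) {t : ℝ} {j : ℕ} (h : (t, j) ∈ S) :
    frobNorm (ξ t j).psi ≤ P.psiM := by
  have hφ := hP.phiM_pos
  have harc : IsPerturbedArc S (fun _ _ y => -P.lamc • y) (fun _ _ y => (1 - P.lamd) • y) P.phiM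
      (t, j) (fun s k => EstState.psiL (ξ s k)) :=
    { dom := hξ.dom
      arc := isHybridArc_clm hξ EstState.psiL
      nonneg := hφ.le
      flow := fun k => by
        filter_upwards [ae_hasDerivAt_clm hξ EstState.psiL k] with s hs hmem _
        have hE := (hξ.mem_state s k (mem_of_mem_interior_timeSlice hmem)).2
        exact ⟨_, frobNorm_eq_norm _ ▸ hphic _ _ hE, psiL_flowMap (P := P) (ξ s k) ▸ hs hmem⟩
      jump := fun k s hs _ =>
        have hD := hξ.jump_mem s k hs
        ⟨_, frobNorm_eq_norm _ ▸ hphid _ _ ⟨hD.1.2, hD.2⟩,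
          (congrArg EstState.psiL (hξ.jump s k hs)).trans (psiL_jumpMap (ξ s k))⟩ }
  have hr : |1 - P.lamd| ≤ Real.exp (-0) := by
    simpa using abs_le.2 ⟨by linarith [hP.lamd_mem.2], by linarith [hP.lamd_mem.1]⟩
  have hbound := harc.norm_le_exp_mul_add (R := P.psiGain * P.phiM) h hP.lamc_pos hP.lamc_pos.le hr
    (by nlinarith [hP.one_le_lamc_mul_psiGain]) (by nlinarith [hP.one_le_gap_mul_psiGain])
  simp only [neg_zero, zero_mul, Real.exp_zero, one_mul, EstState.norm_psiL] at hbound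
  exact hbound.trans (add_le_add_left hψ0 _)

theorem norm_eps_le (hP : P.Admissible) {t : ℝ} {j : ℕ} (h : (t, j) ∈ S)
    (hfin : hybridSupNorm S (W.dEps P S ξ) t j ≠ ∞) :
    ‖W.eps (ξ t j)‖ ≤ Real.exp (-P.lamEps * (t + j)) * ‖W.eps (ξ 0 0)‖
      + P.rhoEps * (hybridSupNorm S (W.dEps P S ξ) t j).toReal := by
  have harc : IsPerturbedArc S (fun _ _ y => -P.lamc • y) (fun _ _ y => (1 - P.lamd) • y)
      (hybridSupNorm S (W.dEps P S ξ) t j).toReal (t, j) (fun s k => W.epsL (ξ s k)) := by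
    refine .of_hybridSupNorm (f := W.dEps P S ξ) (b := (t, j)) hξ.dom (isHybridArc_clm hξ W.epsL)
      hfin (fun k => ?_) fun k s hs => ?_
    · filter_upwards [ae_hasDerivAt_clm hξ W.epsL k] with s hs hmem hjump
      rw [dEps, if_neg hjump]
      exact eps_flowMap (W := W) (P := P) (ξ := ξ) s k ▸ hs hmem
    · rw [dEps, if_pos hs]
      exact (congrArg W.eps (hξ.jump s k hs)).trans (eps_jumpMap s k)
  have hD := harc.nonneg
  exact harc.norm_le_exp_mul_add h hP.lamc_pos hP.lamEps_le_lamc hP.abs_one_sub_lamd_le_exp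
    (by nlinarith [hP.one_le_lamc_mul_rhoEps]) (by nlinarith [hP.one_le_gap_mul_rhoEps])

theorem isSlicewiseContinuous_psi : IsSlicewiseContinuous S fun t j => (ξ t j).psi := by
  intro k c d hsub
  refine continuousOn_pi.2 fun i => continuousOn_pi.2 fun a => ?_
  have hentry : Continuous fun ζ : EstState n p => ζ.psi i a := by
    simp only [EstState.psi, Matrix.of_apply]
    fun_prop
  exact hentry.comp_continuousOn (IsHybridArc.isSlicewiseContinuous hξ.abs_cont k c d hsub)

theorem isPerturbedGradientArc (hP : P.Admissible)
    (hψ : ∀ s k, (s, k) ∈ S → frobNorm (ξ s k).psi ≤ P.psiM) {t : ℝ} {j : ℕ}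
    (hfin : hybridSupNorm S (W.dTot P S ξ) t j ≠ ∞) :
    IsPerturbedGradientArc S (fun s k => (ξ s k).psi) P.gamc P.gamd P.psiM
      (hybridSupNorm S (W.dTot P S ξ) t j).toReal (t, j) (fun s k => W.theta - (ξ s k).th) where
  toIsPerturbedArc := by
    have herr : IsHybridArc S fun s k => W.theta - (ξ s k).th :=
      (isHybridArc_clm hξ EstState.thL).comp_lipschitz (L := fun y => W.theta - y) (K := 1)
        (LipschitzWith.of_dist_le_mul fun x y => by rw [dist_sub_left, NNReal.coe_one, one_mul])
    refine .of_hybridSupNorm (f := W.dTot P S ξ) (b := (t, j)) hξ.dom herr hfin (fun k => ?_)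
      fun k s hs => ?_
    · filter_upwards [ae_hasDerivAt_clm hξ EstState.thL k] with s hs hmem hjump
      rw [dTot, if_neg hjump]
      exact neg_th_flowMap (W := W) (P := P) (ξ := ξ) s k ▸ (hs hmem).const_sub W.theta
    · rw [dTot, if_pos hs]
      exact theta_sub_th_succ hξ hs
  γc_pos := hP.gamc_pos
  γd_pos := hP.gamd_pos
  continuous := isSlicewiseContinuous_psi hξ
  bound s k hs := (specNorm_le_frobNorm _).trans (hψ s k hs)

theorem sigma_lt_one (hP : P.Admissible)
    (hψ : ∀ s k, (s, k) ∈ S → frobNorm (ξ s k).psi ≤ P.psiM)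
    (hPE : HybridPE S (fun t j => (ξ t j).psi) P.Delta P.mu)
    (hvoid : (p = 0 ∨ ∀ a ∈ S, ∀ b ∈ S, ¬ IsWindow P.Delta a b) → P.sigma < 1) :
    P.sigma < 1 := by
  by_contra! hσ
  obtain ⟨hp, a, ha, c, hc, hw⟩ : p ≠ 0 ∧ ∃ a ∈ S, ∃ c ∈ S, IsWindow P.Delta a c := by
    simpa using fun h => hσ.not_gt (hvoid h)
  have : NeZero p := ⟨hp⟩
  -- The two ends of a window need not be ordered, hence a second window that ends at `c`.
  obtain ⟨e, he, hec, hstart, hlt⟩ := hξ.dom.exists_le_sum_lt_add_one hc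
    (c := c.1 + c.2 - P.Delta)
    (by linarith [hw.1, hξ.dom.fst_nonneg ha, a.2.cast_nonneg (α := ℝ)])
    (by linarith [hP.Delta_pos])
  have hμ := le_sq_mul_elapsedTime_of_excitation hξ.dom (isSlicewiseContinuous_psi hξ)
    (fun s k hs => (specNorm_le_frobNorm _).trans (hψ s k hs)) he hc hec
    (hPE e he c hc ⟨by linarith, by linarith⟩)
  refine hσ.not_gt (hP.sigma_lt_one_of_mu_le (hμ.trans ?_))
  gcongr
  rw [elapsedTime]
  linarith

theorem norm_theta_sub_th_le (hP : P.Admissible)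
    (hψ : ∀ s k, (s, k) ∈ S → frobNorm (ξ s k).psi ≤ P.psiM)
    (hPE : HybridPE S (fun t j => (ξ t j).psi) P.Delta P.mu) (hσ : P.sigma < 1)
    {t : ℝ} {j : ℕ} (h : (t, j) ∈ S) (hfin : hybridSupNorm S (W.dTot P S ξ) t j ≠ ∞) :
    ‖W.theta - (ξ t j).th‖ ≤ P.kappa0 * Real.exp (-P.lam0 * (t + j)) * ‖W.theta - (ξ 0 0).th‖
      + √2 * P.rho * (hybridSupNorm S (W.dTot P S ξ) t j).toReal := by
  have harc := isPerturbedGradientArc hξ hP hψ hfin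
  rw [hP.kappa0_eq_exp hσ]
  refine harc.norm_le_exp_mul_add (c := (t, j)) hP.Delta_pos (hP.lam0_pos hσ).le ?_
    (hP.three_mul_kappa0_mul_le hσ) (hP.Delta_le_sqrt_two_mul_rho hσ) h le_rfl
  intro a ha c hc hac hcb hw
  have hcontraction := harc.norm_le_sqrt_mul_add_of_excitation ha hc hac hcb hw.2.le
    (by linarith [hP.Delta_pos]) P.rootK_nonneg hP.two_mul_window_mul_le_rootK_sq
    hP.window_sq_mul_le_rootK_sq (hPE a ha c hc hw) hP.sigma_pos.le hσ P.sigma_mul_sq.le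
  rw [hP.sqrt_one_sub_sigma hσ] at hcontraction
  refine hcontraction.trans_eq ?_
  rw [hP.kappa0_eq_exp hσ, neg_mul, Real.exp_neg]
  field_simp

end Solution

end EstData

/-! ### The input-to-state estimate -/

theorem sqrt_sq_add_sq_add_le (a b c d : ℝ) :
    √((a + c) ^ 2 + (b + d) ^ 2) ≤ √(a ^ 2 + b ^ 2) + √(c ^ 2 + d ^ 2) := by
  have hsplit : ((a + c : ℝ) + (b + d : ℝ) * Complex.I : ℂ) =
      (a + b * Complex.I) + (c + d * Complex.I) := by
    push_cast
    ring
  simpa only [← hsplit, Complex.norm_add_mul_I] using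
    norm_add_le (a + b * Complex.I : ℂ) (c + d * Complex.I)

theorem sqrt_sq_add_sq_div_le {z e z₀ e₀ k r A B w : ℝ} (hz : 0 ≤ z) (he : 0 ≤ e) (hk : 0 ≤ k)
    (hr : 0 ≤ r) (hw : 1 ≤ w) (hzA : z ≤ k * z₀ + r * A) (heB : e ≤ k * e₀ + r * B) :
    √(z ^ 2 + e ^ 2 / w) ≤ k * √(z₀ ^ 2 + e₀ ^ 2 / w) + r * √(A ^ 2 + B ^ 2) := by
  have hscale : ∀ y : ℝ, y ^ 2 / w = (y / √w) ^ 2 := fun y => by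
    rw [div_pow, Real.sq_sqrt (by linarith)]
  have hfactor : ∀ {c x y : ℝ}, 0 ≤ c → √((c * x) ^ 2 + (c * y) ^ 2) = c * √(x ^ 2 + y ^ 2) := by
    intro c x y hc
    rw [mul_pow, mul_pow, ← mul_add, Real.sqrt_mul (sq_nonneg c), Real.sqrt_sq hc]
  have heB' : e / √w ≤ k * (e₀ / √w) + r * (B / √w) := by
    rw [← mul_div_assoc, ← mul_div_assoc, ← add_div]
    gcongr
  calc √(z ^ 2 + e ^ 2 / w)
      ≤ √((k * z₀ + r * A) ^ 2 + (k * (e₀ / √w) + r * (B / √w)) ^ 2) := by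
        rw [hscale]
        gcongr
    _ ≤ √((k * z₀) ^ 2 + (k * (e₀ / √w)) ^ 2) + √((r * A) ^ 2 + (r * (B / √w)) ^ 2) :=
        sqrt_sq_add_sq_add_le _ _ _ _
    _ = k * √(z₀ ^ 2 + e₀ ^ 2 / w) + r * √(A ^ 2 + B ^ 2 / w) := by
        rw [hfactor hk, hfactor hr, hscale, hscale]
    _ ≤ k * √(z₀ ^ 2 + e₀ ^ 2 / w) + r * √(A ^ 2 + B ^ 2) := by
        gcongr
        exact div_le_self (sq_nonneg B) hw

theorem enorm_le_mul_enorm_add {V V' : Type*} [NormedAddCommGroup V] [NormedAddCommGroup V']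
    {a : V} {b b' : V'} {c : ℝ} {B : ℝ≥0∞} (h : ‖a‖ ≤ c * ‖b + b'‖) (hb : ‖b‖ₑ ≤ B) :
    ‖a‖ₑ ≤ ENNReal.ofReal c * (B + ‖b'‖ₑ) :=
  calc ‖a‖ₑ ≤ ENNReal.ofReal (c * ‖b + b'‖) := by
        rw [← ofReal_norm]
        exact ENNReal.ofReal_le_ofReal h
    _ = ENNReal.ofReal c * ‖b + b'‖ₑ := by
        rw [ENNReal.ofReal_mul' (norm_nonneg _), ofReal_norm]
    _ ≤ ENNReal.ofReal c * (B + ‖b'‖ₑ) := by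
        gcongr
        exact (enorm_add_le _ _).trans (by gcongr)

namespace EstData

variable {n p m : ℕ} {W : EstData n p m} {P : EstParams} {S : Set (ℝ × ℕ)}
  {ξ : ℝ → ℕ → EstState n p} {t : ℝ} {j : ℕ}

theorem dNu_eq_ofReal (hd : hybridSupNorm S (W.dTot P S ξ) t j ≠ ∞)
    (he : hybridSupNorm S (W.dEps P S ξ) t j ≠ ∞) :
    W.dNu P S ξ t j = ENNReal.ofReal √((hybridSupNorm S (W.dTot P S ξ) t j).toReal ^ 2
      + (hybridSupNorm S (W.dEps P S ξ) t j).toReal ^ 2) := by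
  rw [dNu, Real.sqrt_eq_rpow, ← ENNReal.ofReal_rpow_of_nonneg (by positivity) (by norm_num),
    ENNReal.ofReal_add (by positivity) (by positivity),
    ENNReal.ofReal_pow ENNReal.toReal_nonneg, ENNReal.ofReal_pow ENNReal.toReal_nonneg,
    ENNReal.ofReal_toReal hd, ENNReal.ofReal_toReal he]

theorem dNu_eq_top (h : hybridSupNorm S (W.dTot P S ξ) t j = ∞ ∨
    hybridSupNorm S (W.dEps P S ξ) t j = ∞) : W.dNu P S ξ t j = ∞ := by
  rw [dNu, ENNReal.rpow_eq_top_iff_of_pos (by norm_num)]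
  rcases h with h | h <;> simp [h]

theorem norm_dc_le (hγ : 0 ≤ P.gamc) (hψ : frobNorm (ξ t j).psi ≤ P.psiM) :
    ‖W.dc P ξ t j‖ ≤ P.gamc * P.psiM * ‖W.eps (ξ t j) + W.nuAt ξ t j‖ := by
  rw [dc, norm_neg, norm_smul, Real.norm_of_nonneg hγ, mul_assoc]
  gcongr
  exact (norm_mulE_transpose_le _ _).trans (by gcongr; exact (specNorm_le_frobNorm _).trans hψ)

theorem norm_dd_le (hγ : 0 < P.gamd) (t : ℝ) (j : ℕ) :
    ‖W.dd P ξ t j‖ ≤ 1 / (2 * √P.gamd) * ‖W.eps (ξ t (j + 1)) + W.nuAt ξ t (j + 1)‖ := by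
  rw [dd, ← stepSize, norm_neg, norm_smul, Real.norm_of_nonneg (stepSize_pos _ hγ).le]
  calc stepSize P.gamd (ξ t (j + 1)).psi
        * ‖mulE (ξ t (j + 1)).psiᵀ (W.eps (ξ t (j + 1)) + W.nuAt ξ t (j + 1))‖
      ≤ stepSize P.gamd (ξ t (j + 1)).psi * (specNorm (ξ t (j + 1)).psi
        * ‖W.eps (ξ t (j + 1)) + W.nuAt ξ t (j + 1)‖) := by
        gcongr
        · exact (stepSize_pos _ hγ).le
        · exact norm_mulE_transpose_le _ _
    _ ≤ 1 / (2 * √P.gamd) * ‖W.eps (ξ t (j + 1)) + W.nuAt ξ t (j + 1)‖ := by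
        rw [← mul_assoc]
        gcongr
        exact stepSize_mul_specNorm_le _ hγ

theorem norm_dEps_le {Lc Ld : ℝ} (hlamc : 0 ≤ P.lamc)
    (hfc : ∀ x₁ x₂ u, ‖W.fc x₁ u - W.fc x₂ u‖ ≤ Lc * ‖x₁ - x₂‖)
    (hgd : ∀ x₁ x₂ u, ‖W.gd x₁ u - W.gd x₂ u‖ ≤ Ld * ‖x₁ - x₂‖) (t : ℝ) (j : ℕ) :
    ‖W.dEps P S ξ t j‖ ≤ max (P.lamc + Lc) (|1 - P.lamd| + Ld) * ‖W.nuAt ξ t j‖ := by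
  unfold dEps
  split_ifs
  · exact (norm_alphad_le hgd t j).trans (by gcongr; exact le_max_right _ _)
  · exact (norm_alphac_le hlamc hfc t j).trans (by gcongr; exact le_max_left _ _)

section Solution

variable (hξ : (W.noisySystem P).IsSolution S ξ) (hP : P.Admissible)
include hξ hP

theorem enorm_eps_le {Lc Ld : ℝ}
    (hfc : ∀ x₁ x₂ u, ‖W.fc x₁ u - W.fc x₂ u‖ ≤ Lc * ‖x₁ - x₂‖)
    (hgd : ∀ x₁ x₂ u, ‖W.gd x₁ u - W.gd x₂ u‖ ≤ Ld * ‖x₁ - x₂‖) (h : (t, j) ∈ S) :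
    ‖W.eps (ξ t j)‖ₑ ≤ ENNReal.ofReal (Real.exp (-P.lamEps * (t + j)) * ‖W.eps (ξ 0 0)‖)
      + ENNReal.ofReal (P.rhoEps * max (P.lamc + Lc) (|1 - P.lamd| + Ld)) *
          hybridSupNorm S (W.nuAt ξ) t j := by
  have hρ := hP.rhoEps_pos
  have hdEps : hybridSupNorm S (W.dEps P S ξ) t j ≤
      ENNReal.ofReal (max (P.lamc + Lc) (|1 - P.lamd| + Ld)) * hybridSupNorm S (W.nuAt ξ) t j :=
    hybridSupNorm_le_const_mul (norm_dEps_le hP.lamc_pos.le hfc hgd)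
  rw [ENNReal.ofReal_mul hρ.le, mul_assoc]
  refine le_trans ?_ (add_le_add_right (mul_le_mul_right hdEps _) _)
  by_cases hfin : hybridSupNorm S (W.dEps P S ξ) t j = ∞
  · rw [hfin, ENNReal.mul_top (by simpa using hρ), add_top]
    exact le_top
  · rw [← ofReal_norm, ← ENNReal.ofReal_toReal hfin, ← ENNReal.ofReal_mul hρ.le,
      ← ENNReal.ofReal_add (by positivity) (by positivity)]
    exact ENNReal.ofReal_le_ofReal (norm_eps_le hξ hP h hfin)

variable (hψ : ∀ s k, (s, k) ∈ S → frobNorm (ξ s k).psi ≤ P.psiM)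
  (hPE : HybridPE S (fun t j => (ξ t j).psi) P.Delta P.mu) (hσ : P.sigma < 1)
include hψ hPE hσ

theorem infDist_target_le (h : (t, j) ∈ S) (hd : hybridSupNorm S (W.dTot P S ξ) t j ≠ ∞)
    (he : hybridSupNorm S (W.dEps P S ξ) t j ≠ ∞) :
    Metric.infDist (ξ t j) W.target ≤
      P.kappaNu * Real.exp (-P.lamNu * (t + j)) * Metric.infDist (ξ 0 0) W.target
        + P.rhoNu * √((hybridSupNorm S (W.dTot P S ξ) t j).toReal ^ 2
          + (hybridSupNorm S (W.dEps P S ξ) t j).toReal ^ 2) := by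
  have hκ := hP.kappaNu_pos hσ
  have hsum : 0 ≤ t + j := add_nonneg (hξ.dom.fst_nonneg h) j.cast_nonneg
  rw [W.infDist_target (hξ.mem_state t j h), W.infDist_target (hξ.mem_state 0 0 hξ.dom.zero_mem)]
  refine sqrt_sq_add_sq_div_le (norm_nonneg _) (norm_nonneg _) (by positivity) hP.rhoNu_pos.le
    (by nlinarith [sq_nonneg ‖W.theta‖]) ?_ ?_
  · refine (norm_theta_sub_th_le hξ hP hψ hPE hσ h hd).trans ?_
    gcongr
    exacts [hP.kappa0_le_kappaNu hσ, hP.lamNu_le_lam0 hσ, EstParams.sqrt_two_mul_rho_le_rhoNu]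
  · refine (norm_eps_le hξ hP h he).trans ?_
    rw [← one_mul (Real.exp _)]
    gcongr
    exacts [hP.one_le_kappaNu hσ, EstParams.lamNu_le_lamEps, hP.rhoEps_le_rhoNu]

theorem ofReal_infDist_target_le (h : (t, j) ∈ S) :
    ENNReal.ofReal (Metric.infDist (ξ t j) W.target) ≤
      ENNReal.ofReal (P.kappaNu * Real.exp (-P.lamNu * (t + j)) *
          Metric.infDist (ξ 0 0) W.target)
        + ENNReal.ofReal P.rhoNu * W.dNu P S ξ t j := by
  have hρ := hP.rhoNu_pos
  have hκ := hP.kappaNu_pos hσ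
  by_cases hinf : hybridSupNorm S (W.dTot P S ξ) t j = ∞ ∨ hybridSupNorm S (W.dEps P S ξ) t j = ∞
  · rw [dNu_eq_top hinf, ENNReal.mul_top (by simpa using hρ), add_top]
    exact le_top
  · push Not at hinf
    rw [dNu_eq_ofReal hinf.1 hinf.2, ← ENNReal.ofReal_mul hρ.le,
      ← ENNReal.ofReal_add (mul_nonneg (by positivity) Metric.infDist_nonneg) (by positivity)]
    exact ENNReal.ofReal_le_ofReal (infDist_target_le hξ hP hψ hPE hσ h hinf.1 hinf.2)

end Solution

end EstData

theorem mainTheorem4_general {n p m : ℕ} (W : EstData n p m) (P : EstParams) (hP : P.Admissible)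
    (Lc Ld : ℝ)
    (hfcL : ∀ x₁ x₂ u, ‖W.fc x₁ u - W.fc x₂ u‖ ≤ Lc * ‖x₁ - x₂‖)
    (hgdL : ∀ x₁ x₂ u, ‖W.gd x₁ u - W.gd x₂ u‖ ≤ Ld * ‖x₁ - x₂‖)
    (hphic : ∀ t j, (t, j) ∈ W.E → frobNorm (W.phic t j) ≤ P.phiM)
    (hphid : ∀ t j, (t, j) ∈ jumpPoints W.E → frobNorm (W.phid t j) ≤ P.phiM)
    (S : Set (ℝ × ℕ)) (ξ : ℝ → ℕ → EstState n p)
    (hξ : (W.noisySystem P).IsSolution S ξ) (hξ0 : ξ 0 0 ∈ W.initialSet P)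
    (hPE : HybridPE S (fun t j => (ξ t j).psi) P.Delta P.mu)
    (hvoid : (p = 0 ∨ ∀ a ∈ S, ∀ b ∈ S, ¬ IsWindow P.Delta a b) → P.sigma < 1) :
    (0 < P.kappaNu ∧ 0 < P.lamNu ∧ 0 < P.rhoNu) ∧
    (∀ t j, (t, j) ∈ S →
      ENNReal.ofReal (Metric.infDist (ξ t j) W.target) ≤
        ENNReal.ofReal (P.kappaNu * Real.exp (-P.lamNu * (t + j)) *
            Metric.infDist (ξ 0 0) W.target)
          + ENNReal.ofReal P.rhoNu * W.dNu P S ξ t j) ∧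
    (∀ t j, (t, j) ∈ S →
      ‖W.dc P ξ t j‖ₑ ≤ ENNReal.ofReal (P.gamc * P.psiM) *
        (ENNReal.ofReal (Real.exp (-P.lamEps * (t + j)) * ‖W.eps (ξ 0 0)‖)
          + ENNReal.ofReal (P.rhoEps * max (P.lamc + Lc) (|1 - P.lamd| + Ld)) *
              hybridSupNorm S (W.nuAt ξ) t j
          + ‖W.nuAt ξ t j‖ₑ)) ∧
    (∀ t j, (t, j) ∈ S → ‖W.alphac P ξ t j‖ ≤ (P.lamc + Lc) * ‖W.nuAt ξ t j‖) ∧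
    (∀ t j, (t, j) ∈ jumpPoints S →
      ‖W.dd P ξ t j‖ₑ ≤ ENNReal.ofReal (1 / (2 * √P.gamd)) *
        (ENNReal.ofReal (Real.exp (-P.lamEps * (t + j + 1)) * ‖W.eps (ξ 0 0)‖)
          + ENNReal.ofReal (P.rhoEps * max (P.lamc + Lc) (|1 - P.lamd| + Ld)) *
              hybridSupNorm S (W.nuAt ξ) t (j + 1)
          + ‖W.nuAt ξ t (j + 1)‖ₑ)) ∧
    (∀ t j, (t, j) ∈ jumpPoints S →
      ‖W.alphad P ξ t j‖ ≤ (|1 - P.lamd| + Ld) * ‖W.nuAt ξ t j‖) := by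
  have hψ : ∀ s k, (s, k) ∈ S → frobNorm (ξ s k).psi ≤ P.psiM := fun s k hs =>
    EstData.frobNorm_psi_le hξ hP hphic hphid hξ0.2 hs
  have hσ : P.sigma < 1 := EstData.sigma_lt_one hξ hP hψ hPE hvoid
  have hε := fun t j => EstData.enorm_eps_le hξ hP hfcL hgdL (t := t) (j := j)
  refine ⟨⟨hP.kappaNu_pos hσ, hP.lamNu_pos hσ, hP.rhoNu_pos⟩,
    fun t j h => EstData.ofReal_infDist_target_le hξ hP hψ hPE hσ h,
    fun t j h => enorm_le_mul_enorm_add (EstData.norm_dc_le hP.gamc_pos.le (hψ t j h)) (hε t j h),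
    fun t j _ => EstData.norm_alphac_le hP.lamc_pos.le hfcL t j, fun t j h => ?_,
    fun t j _ => EstData.norm_alphad_le hgdL t j⟩
  refine enorm_le_mul_enorm_add (EstData.norm_dd_le hP.gamd_pos t j) ?_
  simpa only [Nat.cast_succ, add_assoc] using hε t (j + 1) h.2

theorem mainTheorem4 {n p m : ℕ} (W : EstData n p m) (P : EstParams) (hP : P.Admissible)
    (hE : IsHybridTimeDomain W.E)
    (hfc : Continuous fun z : EuclideanSpace ℝ (Fin n) × EuclideanSpace ℝ (Fin m) => W.fc z.1 z.2)
    (hgd : Continuous fun z : EuclideanSpace ℝ (Fin n) × EuclideanSpace ℝ (Fin m) => W.gd z.1 z.2)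
    (Lc Ld : ℝ) (hLc : 0 < Lc) (hLd : 0 < Ld)
    (hfcL : ∀ x₁ x₂ u, ‖W.fc x₁ u - W.fc x₂ u‖ ≤ Lc * ‖x₁ - x₂‖)
    (hgdL : ∀ x₁ x₂ u, ‖W.gd x₁ u - W.gd x₂ u‖ ≤ Ld * ‖x₁ - x₂‖)
    (hphic : ∀ t j, (t, j) ∈ W.E → frobNorm (W.phic t j) ≤ P.phiM)
    (hphid : ∀ t j, (t, j) ∈ jumpPoints W.E → frobNorm (W.phid t j) ≤ P.phiM)
    (S : Set (ℝ × ℕ)) (ξ : ℝ → ℕ → EstState n p)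
    (hξ : (W.noisySystem P).IsSolution S ξ) (hξ0 : ξ 0 0 ∈ W.initialSet P)
    (hPE : HybridPE S (fun t j => (ξ t j).psi) P.Delta P.mu)
    -- only if the excitation condition is void (no parameters or no window in the domain):
    -- `μ` is small enough for the constants `κ₀`, `λ₀` to be defined
    (hvoid : (p = 0 ∨ ∀ a ∈ S, ∀ b ∈ S, ¬ IsWindow P.Delta a b) → P.sigma < 1) :
    (0 < P.kappaNu ∧ 0 < P.lamNu ∧ 0 < P.rhoNu) ∧
    (∀ t j, (t, j) ∈ S →
      ENNReal.ofReal (Metric.infDist (ξ t j) W.target) ≤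
        ENNReal.ofReal (P.kappaNu * Real.exp (-P.lamNu * (t + j)) *
            Metric.infDist (ξ 0 0) W.target)
          + ENNReal.ofReal P.rhoNu * W.dNu P S ξ t j) ∧
    (∀ t j, (t, j) ∈ S →
      ‖W.dc P ξ t j‖ₑ ≤ ENNReal.ofReal (P.gamc * P.psiM) *
        (ENNReal.ofReal (Real.exp (-P.lamEps * (t + j)) * ‖W.eps (ξ 0 0)‖)
          + ENNReal.ofReal (P.rhoEps * max (P.lamc + Lc) (|1 - P.lamd| + Ld)) *
              hybridSupNorm S (W.nuAt ξ) t j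
          + ‖W.nuAt ξ t j‖ₑ)) ∧
    (∀ t j, (t, j) ∈ S → ‖W.alphac P ξ t j‖ ≤ (P.lamc + Lc) * ‖W.nuAt ξ t j‖) ∧
    (∀ t j, (t, j) ∈ jumpPoints S →
      ‖W.dd P ξ t j‖ₑ ≤ ENNReal.ofReal (1 / (2 * √P.gamd)) *
        (ENNReal.ofReal (Real.exp (-P.lamEps * (t + j + 1)) * ‖W.eps (ξ 0 0)‖)
          + ENNReal.ofReal (P.rhoEps * max (P.lamc + Lc) (|1 - P.lamd| + Ld)) *
              hybridSupNorm S (W.nuAt ξ) t (j + 1)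
          + ‖W.nuAt ξ t (j + 1)‖ₑ)) ∧
    (∀ t j, (t, j) ∈ jumpPoints S →
      ‖W.alphad P ξ t j‖ ≤ (|1 - P.lamd| + Ld) * ‖W.nuAt ξ t j‖) := by
  exact mainTheorem4_general W P hP Lc Ld hfcL hgdL hphic hphid S ξ hξ hξ0 hPE hvoid
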